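/- Let $m\ge 1$ be an integer. For $q\in(1,m+1]$, a $q$-expansion of $x\in[0,\frac m{q-1}]$ is a sequence $(c_i)_{i\ge1}$ in $\{0,\dots,m\}^{\mathbb N}$ with $x=\sum_{i\ge1}c_iq^{-i}$. Let $\mathcal U_q$ be the set of $x$ having exactly one $q$-expansion, $\mathcal U_q'$ the set of the $q$-expansions of the elements of $\mathcal U_q$, and $\mathcal U=\{q\in(1,m+1]:1\in\mathcal U_q\}$, with topological closure $\overline{\mathcal U}$. Sequences, and words of equal length, are ordered lexicographically. The greedy expansion $\beta(q)$ of $1$ is its largest $q$-expansion; the quasi-greedy expansion $\alpha(q)$ is the largest $q$-expansion of $1$ that has no last nonzero digit. The reflection of a word or sequence replaces each digit $d$ by $m-d$ and is denoted by a bar; $w^+$ is the word $w$ with its last digit increased by $1$. Let $M=\lfloor m/2\rfloor+1$, and let $(q_0,q_0^*)$ be a connected component of $(M,m+1]\setminus\overline{\mathcal U}$ with $q_0>M$. Let $a=a_1\cdots a_n$ be the shortest nonempty word with $\alpha(q_0)=a^\infty$. Put $c_0=a^+$ (so $c_0^-=a$) and $c_{\ell+1}=c_\ell\,\overline{c_\ell}^{\,+}$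 for $\ell\ge0$. For $\ell\ge1$ let $q_\ell>1$ be the base with $\beta(q_\ell)=c_\ell0^\infty$. A word $u_1\cdots u_p$ over $\{0,\dots,m\}$ with $p\ge1$ is matched to $a$ if $u_p<m$ and, for every $1\le k\le p$, the word $v$ formed by the $n$ letters of $u_1\cdots u_pa_1\cdots a_n$ at the positions $k+1,\dots,k+n$ satisfies $v\le a$ whenever $u_1\cdots u_k\ne m^k$, and $v\ge\overline a$ whenever $u_1\cdots u_k\ne0^k$. Let $\ell\ge1$ and $q\in(q_\ell,q_{\ell+1}]$. Then a sequence $(b_i)$ belongs to $\mathcal U_q'\setminus\mathcal U_{q_0}'$ if and only if $(b_i)$ or its reflection is an infinite sequence of the form $$\omega\,(c_0^-)^{j}(c_{i_1}\overline{c_{i_1}})^{j_1}(c_{i_1}\overline{c_{i_2}})^{l_1}(c_{i_2}\overline{c_{i_2}})^{j_2}\cdots(c_{i_{r-1}}\overline{c_{i_r}})^{l_{r-1}}(c_{i_r}\overline{c_{i_r}})^{j_r},$$ where $\omega$ is a word matched to $a$, $r\ge1$, $0\le i_1<i_2<\cdots<i_r<\ell$ are integers, $j\in\{0,\infty\}$,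 each $l_s\in\{0,1\}$ and each $j_s\in\{0,1,2,\dots\}\cup\{\infty\}$; whatever follows the first infinite power is disregarded. -/

import Mathlib

open Set

namespace UniqueExpansion

/-! ### Expansions in non-integer bases

Digit sequences `c₁c₂⋯` are functions `c : ℕ → ℕ`, where `c i` is the digit `cᵢ₊₁`. -/

/-- `c` is a `q`-expansion of `x` with respect to the digit set `{0, …, m}`. -/
def IsExpansion (m : ℕ) (q x : ℝ) (c : ℕ → ℕ) : Prop :=
  (∀ i, c i ≤ m) ∧ HasSum (fun i => (c i : ℝ) / q ^ (i + 1)) x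

/-- The set `U_q` of the `x ∈ [0, m/(q-1)]` that have a unique `q`-expansion. -/
def univoqueSet (m : ℕ) (q : ℝ) : Set ℝ :=
  {x | x ∈ Icc (0 : ℝ) (m / (q - 1)) ∧ ∃! c, IsExpansion m q x c}

/-- The set `U'_q` of the `q`-expansions of the elements of `U_q`. -/
def univoqueSeqs (m : ℕ) (q : ℝ) : Set (ℕ → ℕ) :=
  {c | ∃ x ∈ univoqueSet m q, IsExpansion m q x c}

/-- The set `U` of the bases `q ∈ (1, m+1]` in which `1` has a unique expansion. -/
def univoqueBases (m : ℕ) : Set ℝ :=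
  {q | q ∈ Ioc (1 : ℝ) (m + 1) ∧ (1 : ℝ) ∈ univoqueSet m q}

/-- A sequence is infinite if it does not have a last nonzero digit. -/
def IsInfiniteSeq (c : ℕ → ℕ) : Prop :=
  ¬ ∃ N, c N ≠ 0 ∧ ∀ i, N < i → c i = 0

/-- `c` is the greedy `q`-expansion of `x`: the lexicographically largest one. -/
def IsGreedy (m : ℕ) (q x : ℝ) (c : ℕ → ℕ) : Prop :=
  IsExpansion m q x c ∧ ∀ d, IsExpansion m q x d → toLex d ≤ toLex c

/-- `c` is the quasi-greedy `q`-expansion of `x`: the lexicographically largest infinite one. -/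
def IsQuasiGreedy (m : ℕ) (q x : ℝ) (c : ℕ → ℕ) : Prop :=
  IsExpansion m q x c ∧ IsInfiniteSeq c ∧
    ∀ d, IsExpansion m q x d → IsInfiniteSeq d → toLex d ≤ toLex c

/-! ### Words -/

/-- The reflection of a word. -/
def reflectWord (m : ℕ) (w : List ℕ) : List ℕ := w.map (fun d => m - d)

/-- The reflection of a sequence. -/
def reflectSeq (m : ℕ) (b : ℕ → ℕ) : ℕ → ℕ := fun i => m - b i

/-- `w⁺`: the last digit of the (nonempty) word `w` is increased by one. -/
def plusWord (w : List ℕ) : List ℕ := w.dropLast ++ [w.getLastD 0 + 1]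

/-- The sequence `w^∞` (for a nonempty word `w`). -/
def periodicSeq (w : List ℕ) : ℕ → ℕ := fun i => w.getD (i % w.length) 0

/-- The sequence `w b₁b₂⋯`. -/
def prependWord (w : List ℕ) (b : ℕ → ℕ) : ℕ → ℕ :=
  fun i => if i < w.length then w.getD i 0 else b (i - w.length)

/-- The words `c_ℓ` generated by `a = c₀⁻`: `c₀ = a⁺` and `c_{ℓ+1} = c_ℓ (reflection of c_ℓ)⁺`. -/
def cWord (m : ℕ) (a : List ℕ) : ℕ → List ℕ
  | 0 => plusWord a
  | ℓ + 1 => cWord m a ℓ ++ plusWord (reflectWord m (cWord m a ℓ))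

/-- `a` is the shortest nonempty word with `α(q) = a^∞`, where `α(q)` is the quasi-greedy
`q`-expansion of `1`. -/
def IsSmallestPeriodicBlock (m : ℕ) (q : ℝ) (a : List ℕ) : Prop :=
  a ≠ [] ∧ IsQuasiGreedy m q 1 (periodicSeq a) ∧
    ∀ w : List ℕ, w ≠ [] → periodicSeq w = periodicSeq a → a.length ≤ w.length

/-- The nonempty word `u` over `{0, …, m}` is matched to `a`. Words of equal length are compared
lexicographically. -/
def IsMatched (m : ℕ) (a u : List ℕ) : Prop :=
  u ≠ [] ∧ (∀ d ∈ u, d ≤ m) ∧ u.getLastD 0 < m ∧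
    ∀ k, 1 ≤ k → k ≤ u.length →
      (u.take k ≠ List.replicate k m → ((u ++ a).drop k).take a.length ≤ a) ∧
      (u.take k ≠ List.replicate k 0 →
        reflectWord m a ≤ ((u ++ a).drop k).take a.length)

/-- Finite or infinite words. -/
inductive ExtWord where
  | fin (w : List ℕ) : ExtWord
  | inf (b : ℕ → ℕ) : ExtWord

/-- Concatenation; nothing after an infinite word is reached. -/
def ExtWord.append : ExtWord → ExtWord → ExtWord
  | .fin u, .fin v => .fin (u ++ v)
  | .fin u, .inf b => .inf (prependWord u b)
  | .inf b, _ => .inf b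

/-- The power `w^j` of a nonempty word, `0 ≤ j ≤ ∞`. -/
def wordPow (w : List ℕ) : ℕ∞ → ExtWord
  | ⊤ => .inf (periodicSeq w)
  | (j : ℕ) => .fin (List.replicate j w).flatten

/-- The product
`(c_{i₀} c̄_{i₀})^{j₀} (c_{i₀} c̄_{i₁})^{l₀} (c_{i₁} c̄_{i₁})^{j₁} ⋯ (c_{i_{r-1}} c̄_{i_r})^{l_{r-1}} (c_{i_r} c̄_{i_r})^{j_r}`,
where the bar is reflection. -/
def blockProduct (m : ℕ) (a : List ℕ) (i : ℕ → ℕ) (j : ℕ → ℕ∞) (l : ℕ → ℕ) : ℕ → ExtWord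
  | 0 => wordPow (cWord m a (i 0) ++ reflectWord m (cWord m a (i 0))) (j 0)
  | r + 1 =>
    ((blockProduct m a i j l r).append
      (wordPow (cWord m a (i r) ++ reflectWord m (cWord m a (i (r + 1)))) (l r))).append
      (wordPow (cWord m a (i (r + 1)) ++ reflectWord m (cWord m a (i (r + 1)))) (j (r + 1)))

/-- `b` is an infinite sequence of the form
`ω a^e (c_{i₀} c̄_{i₀})^{j₀} (c_{i₀} c̄_{i₁})^{l₀} ⋯ (c_{i_r} c̄_{i_r})^{j_r}` with `ω` matched to `a`,
`e ∈ {0, ∞}`, `0 ≤ i₀ < ⋯ < i_r < ℓ`, `0 ≤ j_s ≤ ∞` and `0 ≤ l_s ≤ 1`. -/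
def HasBlockForm (m : ℕ) (a : List ℕ) (ℓ : ℕ) (b : ℕ → ℕ) : Prop :=
  ∃ (ω : List ℕ) (e : ℕ∞) (r : ℕ) (i : ℕ → ℕ) (j : ℕ → ℕ∞) (l : ℕ → ℕ),
    IsMatched m a ω ∧ (e = 0 ∨ e = ⊤) ∧
    (∀ s < r, i s < i (s + 1)) ∧ i r < ℓ ∧ (∀ s < r, l s ≤ 1) ∧
    ((ExtWord.fin ω).append (wordPow a e)).append (blockProduct m a i j l r) = ExtWord.inf b

/-- `(q₀, q₀*)` is a connected component of `(M, m+1] ∖ closure U`, where `M = ⌊m/2⌋ + 1`. -/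
def IsComponent (m : ℕ) (q₀ q₀' : ℝ) : Prop :=
  ∃ x ∈ Ioc ((m / 2 + 1 : ℕ) : ℝ) (m + 1) \ closure (univoqueBases m),
    connectedComponentIn (Ioc ((m / 2 + 1 : ℕ) : ℝ) (m + 1) \ closure (univoqueBases m)) x
      = Ioo q₀ q₀'

end UniqueExpansion

/-!
Let `g` be an expansion of `1` in base `q` whose tails do not exceed `g`. If no tail of `g`
vanishes, then a sequence is the unique expansion of its value exactly when every tail that follows
a digit `< m`, and the reflection of every tail that follows a digit `> 0`, is lexicographically
smaller than `g`. For `q = q₀` one can take `g = A = a^∞`; for `q = q_{ℓ+1}` the greedy expansion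
`c_{ℓ+1} 0^∞` of `1` gives `g = (c_ℓ c̄_ℓ)^∞`.

Suppose that `b` is univoque in base `q_{ℓ+1}` but not in base `q₀`. After a reflection, the first
tail of `b` or of its reflection that violates the bound `A` is a tail `≥ A` of `b` that follows a
digit `< m`. Being smaller than `(c_ℓ c̄_ℓ)^∞`, it begins with copies of `a`, either forever or
until `c_0` appears, and the part of `b` before it is matched to `a`. From there on, since no word
lies strictly between `c̄_k` and `c̄_k⁺`, a tail that starts with `c_k` continues either with
`c̄_k⁺`, so that it starts with `c_{k+1}`, or with `c̄_k`, so that `c_k` can be split off and the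
reflection of the rest starts with `c_k` again. No tail starts with `c_ℓ`, since the reflection of
what follows it would violate the bound `(c_ℓ c̄_ℓ)^∞`; so `k` stays below `ℓ`, and this gives the
asserted form. Conversely, every sequence of this form has such a tail `≥ A`, but all of its
relevant tails are smaller than `c_ℓ 0^∞`, whose value in a base `q > q_ℓ` is less than `1`.
-/

namespace UniqueExpansion

/-! ### Lexicographic comparison of sequences -/

section Lex

variable {m n k N : ℕ} {s t x s' t' b g : ℕ → ℕ}

/-- The sequence `s` without its first `k` digits. -/
def shift (k : ℕ) (s : ℕ → ℕ) : ℕ → ℕ := fun i => s (k + i)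

/-- The first `n` digits of `s` and of `t` form the same word. -/
def Agree (n : ℕ) (s t : ℕ → ℕ) : Prop := ∀ i < n, s i = t i

/-- The word formed by the first `n` digits of `s` is lexicographically smaller than the one
formed by those of `t`. -/
def LtUpTo (n : ℕ) (s t : ℕ → ℕ) : Prop := ∃ d < n, Agree d s t ∧ s d < t d

theorem shift_zero (s : ℕ → ℕ) : shift 0 s = s := by
  funext i
  simp [shift]

theorem shift_shift (j k : ℕ) (s : ℕ → ℕ) : shift j (shift k s) = shift (k + j) s := by
  funext i
  simp [shift, add_assoc]

theorem shift_reflectSeq (m k : ℕ) (s : ℕ → ℕ) :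
    shift k (reflectSeq m s) = reflectSeq m (shift k s) := rfl

theorem reflectSeq_le (m : ℕ) (s : ℕ → ℕ) (i : ℕ) : reflectSeq m s i ≤ m := Nat.sub_le _ _

theorem le_of_reflectSeq_eq (h : reflectSeq m s = t) (i : ℕ) : t i ≤ m :=
  h ▸ reflectSeq_le m s i

theorem reflectSeq_reflectSeq (hs : ∀ i, s i ≤ m) : reflectSeq m (reflectSeq m s) = s :=
  funext fun i => Nat.sub_sub_self (hs i)

theorem reflectSeq_reflectSeq_shift (hs : ∀ i, s i ≤ m) (k : ℕ) :
    reflectSeq m (reflectSeq m (shift k s)) = shift k s :=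
  reflectSeq_reflectSeq fun _ => hs _

theorem Agree.symm (h : Agree n s t) : Agree n t s := fun i hi => (h i hi).symm

theorem Agree.trans (h : Agree n s t) (h' : Agree n t x) : Agree n s x :=
  fun i hi => (h i hi).trans (h' i hi)

theorem Agree.mono (h : Agree n s t) (hk : k ≤ n) : Agree k s t :=
  fun i hi => h i (hi.trans_le hk)

protected theorem Agree.reflectSeq (h : Agree n s t) : Agree n (reflectSeq m s) (reflectSeq m t) :=
  fun i hi => congrArg (m - ·) (h i hi)

theorem agree_add_iff :
    Agree (k + n) s t ↔ Agree k s t ∧ Agree n (shift k s) (shift k t) := by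
  refine ⟨fun h => ⟨h.mono (by omega), fun i hi => h _ (by omega)⟩, fun ⟨h, h'⟩ i hi => ?_⟩
  rcases lt_or_ge i k with hik | hik
  · exact h i hik
  · simpa [shift, Nat.add_sub_cancel' hik] using h' (i - k) (by omega)

protected theorem Agree.shift (h : Agree (k + n) s t) : Agree n (shift k s) (shift k t) :=
  (agree_add_iff.mp h).2

theorem LtUpTo.lex_lt (h : LtUpTo n s t) : toLex s < toLex t := by
  obtain ⟨d, -, hag, hlt⟩ := h
  exact ⟨d, hag, hlt⟩

theorem lex_lt_iff_exists_ltUpTo : toLex s < toLex t ↔ ∃ n, LtUpTo n s t :=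
  ⟨fun ⟨d, hag, hlt⟩ => ⟨d + 1, d, d.lt_succ_self, hag, hlt⟩, fun ⟨_, h⟩ => h.lex_lt⟩

theorem not_ltUpTo_of_lex_le (h : toLex s ≤ toLex t) : ¬ LtUpTo n t s :=
  fun h' => h'.lex_lt.not_ge h

theorem LtUpTo.asymm (h : LtUpTo n s t) : ¬ LtUpTo n t s := not_ltUpTo_of_lex_le h.lex_lt.le

theorem LtUpTo.mono (h : LtUpTo n s t) (hn : n ≤ k) : LtUpTo k s t := by
  obtain ⟨d, hd, hag, hlt⟩ := h
  exact ⟨d, hd.trans_le hn, hag, hlt⟩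

theorem LtUpTo.congr (h : LtUpTo n s t) (hs : Agree n s s') (ht : Agree n t t') :
    LtUpTo n s' t' := by
  obtain ⟨d, hd, hag, hlt⟩ := h
  exact ⟨d, hd, (hs.symm.mono hd.le).trans (hag.trans (ht.mono hd.le)), hs d hd ▸ ht d hd ▸ hlt⟩

theorem LtUpTo.trans (h : LtUpTo n s t) (h' : LtUpTo n t x) : LtUpTo n s x := by
  obtain ⟨d, hd, hag, hlt⟩ := h
  obtain ⟨e, he, hag', hlt'⟩ := h'
  rcases lt_trichotomy d e with hde | rfl | hde
  · exact ⟨d, hd, hag.trans (hag'.mono hde.le), hag' d hde ▸ hlt⟩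
  · exact ⟨d, hd, hag.trans hag', hlt.trans hlt'⟩
  · exact ⟨e, he, (hag.mono hde.le).trans hag', hag e hde ▸ hlt'⟩

theorem ltUpTo_trichotomy (n : ℕ) (s t : ℕ → ℕ) :
    LtUpTo n s t ∨ Agree n s t ∨ LtUpTo n t s := by
  by_cases h : Agree n s t
  · exact .inr (.inl h)
  have hex : ∃ d, d < n ∧ s d ≠ t d := by simpa [Agree] using h
  classical
  obtain ⟨hd, hne⟩ := Nat.find_spec hex
  have hag : Agree (Nat.find hex) s t := fun i hi => by
    by_contra hi'
    exact Nat.find_min hex hi ⟨hi.trans hd, hi'⟩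
  rcases hne.lt_or_gt with hlt | hlt
  · exact .inl ⟨_, hd, hag, hlt⟩
  · exact .inr (.inr ⟨_, hd, hag.symm, hlt⟩)

theorem Agree.ltUpTo_add_iff (h : Agree k s t) :
    LtUpTo (k + n) s t ↔ LtUpTo n (shift k s) (shift k t) := by
  refine ⟨fun ⟨d, hd, hag, hlt⟩ => ?_, fun ⟨d, hd, hag, hlt⟩ =>
    ⟨k + d, by omega, agree_add_iff.mpr ⟨h, hag⟩, hlt⟩⟩
  obtain ⟨e, rfl⟩ : ∃ e, d = k + e := Nat.exists_eq_add_of_le <| by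
    by_contra! hdk
    exact hlt.ne (h d hdk)
  exact ⟨e, by omega, hag.shift, hlt⟩

protected theorem LtUpTo.reflectSeq (h : LtUpTo n s t) (ht : ∀ i, t i ≤ m) :
    LtUpTo n (reflectSeq m t) (reflectSeq m s) := by
  obtain ⟨d, hd, hag, hlt⟩ := h
  exact ⟨d, hd, hag.symm.reflectSeq, Nat.sub_lt_sub_left (hlt.trans_le (ht d)) hlt⟩

theorem LtUpTo.reflectSeq_comm (h : LtUpTo n (reflectSeq m s) t) (hs : ∀ i, s i ≤ m)
    (ht : ∀ i, t i ≤ m) : LtUpTo n (reflectSeq m t) s := by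
  simpa only [reflectSeq_reflectSeq hs] using h.reflectSeq ht

theorem reflectSeq_lex_lt (h : toLex s < toLex t) (ht : ∀ i, t i ≤ m) :
    toLex (reflectSeq m t) < toLex (reflectSeq m s) := by
  obtain ⟨n, hn⟩ := lex_lt_iff_exists_ltUpTo.mp h
  exact (hn.reflectSeq ht).lex_lt

theorem lex_lt_shift (h : Agree k s t) (hlt : toLex s < toLex t) :
    toLex (shift k s) < toLex (shift k t) := by
  obtain ⟨n, hn⟩ := lex_lt_iff_exists_ltUpTo.mp hlt
  exact (h.ltUpTo_add_iff.mp (hn.mono (Nat.le_add_left n k))).lex_lt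

theorem lex_le_shift (h : Agree k s t) (hle : toLex s ≤ toLex t) :
    toLex (shift k s) ≤ toLex (shift k t) := by
  rcases hle.lt_or_eq with hlt | heq
  · exact (lex_lt_shift h hlt).le
  · rw [toLex.injective heq]

theorem lex_le_head (h : toLex s ≤ toLex t) : s 0 ≤ t 0 := by
  by_contra! hlt
  exact not_ltUpTo_of_lex_le h (n := 1) ⟨0, one_pos, fun i hi => absurd hi i.not_lt_zero, hlt⟩

theorem lex_shift_one_le_self (hg : ∀ i, g i ≤ m) (h0 : g 0 = m) :
    toLex (shift 1 g) ≤ toLex g := by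
  by_contra! hlt
  obtain ⟨d, hag, hlt⟩ := hlt
  have hm : ∀ i ≤ d, g i = m := by
    intro i hi
    induction i with
    | zero => exact h0
    | succ i ih => rw [add_comm, ← ih (by omega)]; exact (hag i hi).symm
  exact (hlt.trans_le (hg (1 + d))).ne (hm d le_rfl)

theorem agree_one_of_lex_le_of_head_eq (hg : ∀ i, g i ≤ m) (h : toLex t ≤ toLex g)
    (h0 : t 0 = m) : Agree 1 t g ∧ g 0 = m := by
  have hg0 : g 0 = m := le_antisymm (hg 0) (h0 ▸ lex_le_head h)
  refine ⟨fun i hi => ?_, hg0⟩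
  rw [Nat.lt_one_iff.mp hi, h0, hg0]

theorem lex_shift_one_le (hg : ∀ i, g i ≤ m) (h : toLex t ≤ toLex g) (h0 : t 0 = m) :
    toLex (shift 1 t) ≤ toLex g :=
  have ⟨hag, hg0⟩ := agree_one_of_lex_le_of_head_eq hg h h0
  (lex_le_shift hag h).trans (lex_shift_one_le_self hg hg0)

theorem lex_shift_one_lt (hg : ∀ i, g i ≤ m) (h : toLex t < toLex g) (h0 : t 0 = m) :
    toLex (shift 1 t) < toLex g :=
  have ⟨hag, hg0⟩ := agree_one_of_lex_le_of_head_eq hg h.le h0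
  (lex_lt_shift hag h).trans_le (lex_shift_one_le_self hg hg0)

theorem lex_shift_lt_of_exists_digit_lt (hb : ∀ i, b i ≤ m) (hg : ∀ i, g i ≤ m)
    (h : ∀ i < k, b i < m → toLex (shift (i + 1) b) < toLex g) (hk : ∃ i < k, b i < m) :
    toLex (shift k b) < toLex g := by
  induction k with
  | zero => simp at hk
  | succ k ih =>
    by_cases hbk : b k < m
    · exact h k k.lt_succ_self hbk
    obtain ⟨i, hi, hbi⟩ := hk
    have hik : i < k := lt_of_le_of_ne (Nat.lt_succ_iff.mp hi) (by rintro rfl; exact hbk hbi)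
    rw [← shift_shift]
    exact lex_shift_one_lt hg (ih (fun i hi => h i (by omega)) ⟨i, hik, hbi⟩)
      (le_antisymm (hb k) (not_lt.mp hbk))

theorem reflectSeq_lex_shift_lt_of_exists_digit_pos (hb : ∀ i, b i ≤ m) (hg : ∀ i, g i ≤ m)
    (h : ∀ i < k, 0 < b i → toLex (reflectSeq m (shift (i + 1) b)) < toLex g)
    (hk : ∃ i < k, 0 < b i) : toLex (reflectSeq m (shift k b)) < toLex g := by
  have hrefl : ∀ i, reflectSeq m b i < m ↔ 0 < b i := fun i => by
    have := hb i
    simp only [reflectSeq]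
    omega
  rw [← shift_reflectSeq]
  refine lex_shift_lt_of_exists_digit_lt (reflectSeq_le m b) hg
    (fun i hi hbi => h i hi ((hrefl i).mp hbi)) ?_
  simpa only [hrefl] using hk

theorem lex_shift_le_self_of_forall (hg : ∀ i, g i ≤ m)
    (h : ∀ i, g i < m → toLex (shift (i + 1) g) ≤ toLex g) (k : ℕ) :
    toLex (shift k g) ≤ toLex g := by
  induction k with
  | zero => rw [shift_zero]
  | succ k ih =>
    by_cases hk : g k < m
    · exact h k hk
    · rw [← shift_shift]
      exact lex_shift_one_le hg ih (le_antisymm (hg k) (not_lt.mp hk))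

theorem reflectSeq_lex_shift_le_of_forall (hg : ∀ i, g i ≤ m)
    (h0 : toLex (reflectSeq m g) ≤ toLex g)
    (h : ∀ i, 0 < g i → toLex (reflectSeq m (shift (i + 1) g)) ≤ toLex g) (k : ℕ) :
    toLex (reflectSeq m (shift k g)) ≤ toLex g := by
  induction k with
  | zero => rwa [shift_zero]
  | succ k ih =>
    by_cases hk : 0 < g k
    · exact h k hk
    · rw [← shift_shift]
      exact lex_shift_one_le hg ih (by simp [shift, reflectSeq, Nat.eq_zero_of_not_pos hk])

/-- The first `N` digits of `t` form the word `w⁺`, where `w` is formed by those of `s`. -/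
def IsPlus (N : ℕ) (s t : ℕ → ℕ) : Prop := ∃ k, k + 1 = N ∧ Agree k s t ∧ t k = s k + 1

theorem IsPlus.ltUpTo (h : IsPlus N s t) : LtUpTo N s t := by
  obtain ⟨k, rfl, hag, hk⟩ := h
  exact ⟨k, k.lt_succ_self, hag, by omega⟩

theorem IsPlus.agree (h : IsPlus N s t) : Agree (N - 1) s t := by
  obtain ⟨k, rfl, hag, -⟩ := h
  exact hag

theorem IsPlus.congr (h : IsPlus N s t) (hs : Agree N s s') (ht : Agree N t t') :
    IsPlus N s' t' := by
  obtain ⟨k, rfl, hag, hk⟩ := h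
  exact ⟨k, rfl, (hs.symm.mono k.le_succ).trans (hag.trans (ht.mono k.le_succ)),
    by rw [← hs k k.lt_succ_self, ← ht k k.lt_succ_self, hk]⟩

protected theorem IsPlus.shift (h : IsPlus (k + N) s t) (hN : 0 < N) :
    IsPlus N (shift k s) (shift k t) := by
  obtain ⟨d, hd, hag, hlast⟩ := h
  obtain ⟨e, rfl⟩ : ∃ e, N = e + 1 := ⟨N - 1, by omega⟩
  obtain rfl : d = k + e := by omega
  exact ⟨e, rfl, hag.shift, hlast⟩

theorem IsPlus.of_shift (hag : Agree k s t) (h : IsPlus N (shift k s) (shift k t)) :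
    IsPlus (k + N) s t := by
  obtain ⟨d, rfl, hag', hlast⟩ := h
  exact ⟨k + d, rfl, agree_add_iff.mpr ⟨hag, hag'⟩, hlast⟩

protected theorem IsPlus.reflectSeq (h : IsPlus N s t) (ht : ∀ i < N, t i ≤ m) :
    IsPlus N (reflectSeq m t) (reflectSeq m s) := by
  obtain ⟨k, rfl, hag, hk⟩ := h
  refine ⟨k, rfl, hag.symm.reflectSeq, ?_⟩
  have := ht k k.lt_succ_self
  simp only [reflectSeq]
  omega

/-- No word lies strictly between `w` and `w⁺`. -/
theorem IsPlus.ltUpTo_iff (h : IsPlus N s t) : LtUpTo N x t ↔ ¬ LtUpTo N s x := by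
  constructor
  · rintro ⟨d, hd, hxt, hlt⟩ ⟨e, he, hsx, hlt'⟩
    obtain ⟨k, rfl, hst, hk⟩ := h
    rcases lt_trichotomy e d with hed | rfl | hed
    · exact hlt'.ne ((hst e (by omega)).trans (hxt e hed).symm)
    · rcases Nat.lt_succ_iff_lt_or_eq.mp hd with hek | rfl
      · have := hst e hek
        omega
      · omega
    · exact hlt.ne ((hsx d hed).symm.trans (hst d (by omega)))
  · intro hsx
    rcases ltUpTo_trichotomy N s x with h' | h' | h'
    · exact absurd h' hsx
    · exact h.ltUpTo.congr h' fun _ _ => rfl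
    · exact h'.trans h.ltUpTo

theorem IsPlus.agree_or_agree (h : IsPlus N s t) (hs : ¬ LtUpTo N x s) (ht : ¬ LtUpTo N t x) :
    Agree N x s ∨ Agree N x t := by
  rcases ltUpTo_trichotomy N x t with h1 | h1 | h1
  · rcases ltUpTo_trichotomy N x s with h2 | h2 | h2
    · exact absurd h2 hs
    · exact .inl h2
    · exact absurd h2 (h.ltUpTo_iff.mp h1)
  · exact .inr h1
  · exact absurd h1 ht

end Lex

/-! ### The limit of the words `c_k` -/

/-- The suffixes of the word `w` formed by the first `N` digits of `C` are not larger than the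
prefixes of `w` of the same length, and their reflections are smaller. -/
def Admissible (m N : ℕ) (C : ℕ → ℕ) : Prop :=
  ∀ i < N, ¬ LtUpTo (N - i) C (shift i C) ∧ LtUpTo (N - i) (reflectSeq m (shift i C)) C

/-- `C` starts with the words `c_k`, where `c_k` has length `n 2 ^ k`, and
`c_{k+1}` is `c_k` followed by the successor of its reflection. -/
structure IsTower (m n : ℕ) (C : ℕ → ℕ) : Prop where
  pos : 0 < n
  le₀ : ∀ i < n, C i ≤ m
  admissible₀ : Admissible m n C
  isPlus : ∀ k, IsPlus (n * 2 ^ k) (reflectSeq m C) (shift (n * 2 ^ k) C)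

/-- All tails of `t` and of its reflection are smaller than `g`. -/
def TailsLt (m : ℕ) (g t : ℕ → ℕ) : Prop :=
  ∀ K, toLex (shift K t) < toLex g ∧ toLex (reflectSeq m (shift K t)) < toLex g

/-- The first `N` digits of each tail of `t` and of its reflection form a word that is smaller
than the one formed by those of `C`. -/
def TailsLtUpTo (m N : ℕ) (C t : ℕ → ℕ) : Prop :=
  ∀ K, LtUpTo N (shift K t) C ∧ LtUpTo N (reflectSeq m (shift K t)) C

/-- `t` starts with the first `N` digits of `C` and their reflection. -/
def StartsWithPair (m N : ℕ) (C t : ℕ → ℕ) : Prop :=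
  Agree N t C ∧ Agree N (reflectSeq m (shift N t)) C

section

variable {m n N k l K : ℕ} {C g t : ℕ → ℕ}

theorem Admissible.double (h : Admissible m N C) (hC : ∀ i, C i ≤ m)
    (hplus : IsPlus N (reflectSeq m C) (shift N C)) : Admissible m (N * 2) C := by
  intro i hi
  rcases lt_or_ge i N with hiN | hiN
  · refine ⟨?_, (h i hiN).2.mono (by omega)⟩
    rcases Nat.eq_zero_or_pos i with rfl | hi0
    · rw [shift_zero]
      exact fun hlt => hlt.asymm hlt
    rcases ltUpTo_trichotomy (N - i) C (shift i C) with hlt | hag | hgt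
    · exact absurd hlt (h i hiN).1
    · have hsuffix : LtUpTo i (reflectSeq m C) (shift (N - i) C) := by
        have := (h (N - i) (by omega)).2.reflectSeq_comm (fun j => hC _) hC
        rwa [Nat.sub_sub_self hiN.le] at this
      rw [show N * 2 - i = N - i + N by omega, hag.ltUpTo_add_iff, shift_shift,
        Nat.add_sub_cancel' hiN.le, hplus.ltUpTo_iff, not_not]
      exact hsuffix.mono hiN.le
    · exact (hgt.mono (by omega)).asymm
  · obtain ⟨k, rfl⟩ := Nat.exists_eq_add_of_le hiN
    obtain ⟨hle, hlt⟩ := h k (by omega)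
    have hplus_k : IsPlus (N - k) (reflectSeq m (shift k C)) (shift (N + k) C) := by
      rw [← shift_shift]
      have hkN : k + (N - k) = N := by omega
      exact IsPlus.shift (by rwa [hkN]) (by omega)
    have hplus_k' : IsPlus (N - k) (reflectSeq m (shift (N + k) C)) (shift k C) := by
      simpa only [reflectSeq_reflectSeq_shift hC]
        using hplus_k.reflectSeq fun j _ => hC (N + k + j)
    rw [show N * 2 - (N + k) = N - k by omega, hplus_k.ltUpTo_iff, not_not]
    exact ⟨hlt, not_not.mp fun hnlt => hle (hplus_k'.ltUpTo_iff.mpr hnlt)⟩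

protected theorem TailsLt.shift (h : TailsLt m g t) (k : ℕ) : TailsLt m g (shift k t) := fun K => by
  rw [shift_shift]
  exact h _

protected theorem TailsLt.reflectSeq (h : TailsLt m g t) (ht : ∀ i, t i ≤ m) :
    TailsLt m g (reflectSeq m t) := fun K => by
  rw [shift_reflectSeq, reflectSeq_reflectSeq_shift ht]
  exact (h K).symm

theorem forall_shift_of_reflectSeq_shift_eq {P : (ℕ → ℕ) → Prop} (hN : 0 < N)
    (ht : reflectSeq m (shift N t) = t)
    (h : ∀ K < N, P (shift K t) ∧ P (reflectSeq m (shift K t))) (K : ℕ) :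
    P (shift K t) ∧ P (reflectSeq m (shift K t)) := by
  induction K using Nat.strong_induction_on with
  | _ K ih =>
    rcases lt_or_ge K N with hK | hK
    · exact h K hK
    obtain ⟨e, rfl⟩ := Nat.exists_eq_add_of_le hK
    have hstep : reflectSeq m (shift (N + e) t) = shift e t := by
      rw [← shift_shift, ← shift_reflectSeq, ht]
    have hstep' : shift (N + e) t = reflectSeq m (shift e t) := by
      rw [← hstep, reflectSeq_reflectSeq_shift (le_of_reflectSeq_eq ht)]
    rw [hstep, hstep']
    exact (ih e (by omega)).symm

namespace IsTower

theorem length_mono (n : ℕ) (hkl : k ≤ l) : n * 2 ^ k ≤ n * 2 ^ l :=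
  Nat.mul_le_mul_left _ (Nat.pow_le_pow_right two_pos hkl)

theorem length_pos (h : IsTower m n C) (k : ℕ) : 0 < n * 2 ^ k :=
  Nat.mul_pos h.pos (Nat.two_pow_pos k)

theorem last_pos (h : IsTower m n C) (k i : ℕ) (hi : i + 1 = n * 2 ^ k) : 0 < C i := by
  cases k with
  | zero =>
    obtain rfl : n = i + 1 := by omega
    obtain ⟨d, hd, -, hlt⟩ := (h.admissible₀ i i.lt_succ_self).2
    obtain rfl : d = 0 := by omega
    have := h.le₀ 0 h.pos
    simp only [reflectSeq, shift, add_zero] at hlt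
    omega
  | succ k =>
    obtain ⟨j, hj, -, hlast⟩ := h.isPlus k
    rw [pow_succ, ← mul_assoc] at hi
    obtain rfl : i = n * 2 ^ k + j := by omega
    exact Nat.pos_of_ne_zero fun h0 => by simp [shift, h0] at hlast

theorem le (h : IsTower m n C) (i : ℕ) : C i ≤ m := by
  have hle : ∀ k, ∀ i < n * 2 ^ k, C i ≤ m := by
    intro k
    induction k with
    | zero => simpa using h.le₀
    | succ k ih =>
      intro i hi
      rcases lt_or_ge i (n * 2 ^ k) with hik | hik
      · exact ih i hik
      obtain ⟨e, rfl⟩ := Nat.exists_eq_add_of_le hik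
      obtain ⟨j, hj, hag, hlast⟩ := h.isPlus k
      rw [pow_succ, ← mul_assoc] at hi
      rcases Nat.lt_succ_iff_lt_or_eq.mp (show e < j + 1 by omega) with hej | rfl
      · exact (hag e hej).ge.trans (reflectSeq_le m C e)
      · have := h.last_pos k e hj
        have := ih e (by omega)
        simp only [shift, reflectSeq] at hlast
        omega
  exact hle i i (Nat.lt_two_pow_self.trans_le (Nat.le_mul_of_pos_left _ h.pos))

theorem admissible (h : IsTower m n C) (k : ℕ) : Admissible m (n * 2 ^ k) C := by
  induction k with
  | zero => simpa using h.admissible₀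
  | succ k ih =>
    rw [pow_succ, ← mul_assoc]
    exact ih.double h.le (h.isPlus k)

theorem reflectSeq_shift_ltUpTo (h : IsTower m n C) (ht : Agree (n * 2 ^ k) t C)
    (hK : K < n * 2 ^ k) : LtUpTo (n * 2 ^ k) (reflectSeq m (shift K t)) C := by
  have ht' : Agree (n * 2 ^ k - K) (shift K t) (shift K C) :=
    Agree.shift (by rwa [Nat.add_sub_cancel' hK.le])
  exact ((h.admissible k K hK).2.congr ht'.symm.reflectSeq fun _ _ => rfl).mono (Nat.sub_le _ _)

theorem shift_ltUpTo (h : IsTower m n C) (ht : StartsWithPair m (n * 2 ^ k) C t)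
    (htm : ∀ i, t i ≤ m) (hK0 : 0 < K) (hK : K < n * 2 ^ k) :
    LtUpTo (n * 2 ^ k) (shift K t) C := by
  obtain ⟨hag, hag'⟩ := ht
  set N := n * 2 ^ k
  have hKN : K + (N - K) = N := Nat.add_sub_cancel' hK.le
  have htK : Agree (N - K) (shift K t) (shift K C) := Agree.shift (by rwa [hKN])
  rcases ltUpTo_trichotomy (N - K) (shift K C) C with hlt | heq | hgt
  · exact (hlt.congr htK.symm fun _ _ => rfl).mono (Nat.sub_le _ _)
  · have hlow : LtUpTo K (reflectSeq m (shift (N - K) C)) (reflectSeq m (shift N t)) := by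
      have := (h.admissible k (N - K) (by omega)).2
      rw [Nat.sub_sub_self hK.le] at this
      exact this.congr (fun _ _ => rfl) (hag'.symm.mono hK.le)
    rw [show N = N - K + K by omega, (htK.trans heq).ltUpTo_add_iff, shift_shift, hKN]
    simpa only [reflectSeq_reflectSeq_shift h.le,
      reflectSeq_reflectSeq_shift htm] using hlow.reflectSeq (reflectSeq_le m _)
  · exact absurd hgt (h.admissible k K hK).1

theorem ltUpTo_succ (h : IsTower m n C) (ht : StartsWithPair m (n * 2 ^ k) C t)
    (htm : ∀ i, t i ≤ m) : LtUpTo (n * 2 ^ (k + 1)) t C := by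
  have hag : Agree (n * 2 ^ k) (reflectSeq m C) (shift (n * 2 ^ k) t) := by
    simpa only [reflectSeq_reflectSeq_shift htm] using ht.2.symm.reflectSeq (m := m)
  rw [pow_succ, ← mul_assoc, mul_two, ht.1.ltUpTo_add_iff]
  exact (h.isPlus k).ltUpTo.congr hag fun _ _ => rfl

theorem shift_ltUpTo_and_reflectSeq (h : IsTower m n C) (hkl : k < l)
    (ht : StartsWithPair m (n * 2 ^ k) C t) (htm : ∀ i, t i ≤ m) (hK : K < n * 2 ^ k) :
    LtUpTo (n * 2 ^ l) (shift K t) C ∧ LtUpTo (n * 2 ^ l) (reflectSeq m (shift K t)) C := by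
  refine ⟨?_, (h.reflectSeq_shift_ltUpTo ht.1 hK).mono (length_mono n hkl.le)⟩
  rcases Nat.eq_zero_or_pos K with rfl | hK0
  · rw [shift_zero]
    exact (h.ltUpTo_succ ht htm).mono (length_mono n hkl)
  · exact (h.shift_ltUpTo ht htm hK0 hK).mono (length_mono n hkl.le)

theorem tailsLtUpTo_of_reflectSeq_shift (h : IsTower m n C) (hkl : k < l)
    (ht : StartsWithPair m (n * 2 ^ k) C t) (htm : ∀ i, t i ≤ m)
    (htail : TailsLtUpTo m (n * 2 ^ l) C (reflectSeq m (shift (n * 2 ^ k) t))) :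
    TailsLtUpTo m (n * 2 ^ l) C t := by
  intro K
  rcases lt_or_ge K (n * 2 ^ k) with hK | hK
  · exact h.shift_ltUpTo_and_reflectSeq hkl ht htm hK
  · obtain ⟨e, rfl⟩ := Nat.exists_eq_add_of_le hK
    have := htail e
    rw [shift_reflectSeq, shift_shift, reflectSeq_reflectSeq_shift htm] at this
    exact this.symm

theorem tailsLtUpTo_of_reflectSeq_shift_eq (h : IsTower m n C) (hkl : k < l)
    (ht : Agree (n * 2 ^ k) t C) (ht' : reflectSeq m (shift (n * 2 ^ k) t) = t) :
    TailsLtUpTo m (n * 2 ^ l) C t :=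
  forall_shift_of_reflectSeq_shift_eq (P := (LtUpTo (n * 2 ^ l) · C)) (h.length_pos k) ht'
    fun _ hK => h.shift_ltUpTo_and_reflectSeq hkl ⟨ht, by rwa [ht']⟩ (le_of_reflectSeq_eq ht') hK

theorem lex_shift_le_of_reflectSeq_shift_eq (h : IsTower m n C)
    (ht : Agree (n * 2 ^ k) t C) (ht' : reflectSeq m (shift (n * 2 ^ k) t) = t) (K : ℕ) :
    toLex (shift K t) ≤ toLex t ∧ toLex (reflectSeq m (shift K t)) ≤ toLex t := by
  refine forall_shift_of_reflectSeq_shift_eq (P := (toLex · ≤ toLex t)) (h.length_pos k) ht'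
    (fun K hK => ⟨?_, ?_⟩) K
  · rcases Nat.eq_zero_or_pos K with rfl | hK0
    · rw [shift_zero]
    · exact ((h.shift_ltUpTo ⟨ht, by rwa [ht']⟩ (le_of_reflectSeq_eq ht') hK0 hK).congr
        (fun _ _ => rfl) ht.symm).lex_lt.le
  · exact ((h.reflectSeq_shift_ltUpTo ht hK).congr (fun _ _ => rfl) ht.symm).lex_lt.le

theorem agree_succ_or_startsWithPair (h : IsTower m n C) (hkl : k < l)
    (hg : Agree (n * 2 ^ l) g C) (hlt : TailsLt m g t) (ht : Agree (n * 2 ^ k) t C) :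
    Agree (n * 2 ^ (k + 1)) t C ∨ StartsWithPair m (n * 2 ^ k) C t := by
  have hNl : n * 2 ^ k + n * 2 ^ k ≤ n * 2 ^ l := by
    rw [← mul_two, mul_assoc, ← pow_succ]
    exact length_mono n hkl
  rw [pow_succ, ← mul_assoc, mul_two]
  set N := n * 2 ^ k
  have hlow : ¬ LtUpTo N (shift N t) (reflectSeq m C) := fun hlt' => by
    have := hlt'.reflectSeq (reflectSeq_le m C)
    rw [reflectSeq_reflectSeq h.le] at this
    exact not_ltUpTo_of_lex_le (hlt N).2.le
      (this.congr (hg.symm.mono (by omega)) fun _ _ => rfl)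
  have hup : ¬ LtUpTo N (shift N C) (shift N t) := fun hlt' =>
    not_ltUpTo_of_lex_le (hlt 0).1.le <| by
      rw [shift_zero]
      exact (ht.symm.ltUpTo_add_iff.mpr hlt').congr (hg.symm.mono hNl) fun _ _ => rfl
  rcases (h.isPlus k).agree_or_agree hlow hup with heq | heq
  · refine .inr ⟨ht, ?_⟩
    simpa only [reflectSeq_reflectSeq h.le] using heq.reflectSeq (m := m)
  · exact .inl (agree_add_iff.mpr ⟨ht, heq⟩)

theorem not_agree_top (hg : reflectSeq m (shift N g) = g) (hlt : TailsLt m g t) :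
    ¬ Agree N t g := fun hag => by
  have hshift := lex_lt_shift hag (by simpa only [shift_zero] using (hlt 0).1)
  have hrefl := reflectSeq_lex_lt hshift fun i => le_of_reflectSeq_eq hg _
  rw [hg] at hrefl
  exact hrefl.asymm (hlt _).2

theorem exists_startsWithPair (h : IsTower m n C) (hkl : k < l)
    (hg : Agree (n * 2 ^ l) g C) (hg' : reflectSeq m (shift (n * 2 ^ l) g) = g)
    (hlt : TailsLt m g t) (ht : Agree (n * 2 ^ k) t C) :
    ∃ k', k ≤ k' ∧ k' < l ∧ StartsWithPair m (n * 2 ^ k') C t := by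
  induction hd : l - k generalizing k with
  | zero => omega
  | succ d ih =>
    rcases h.agree_succ_or_startsWithPair hkl hg hlt ht with hsucc | hpair
    · rcases Nat.lt_or_ge (k + 1) l with hkl' | hkl'
      · obtain ⟨k', hk', hpair⟩ := ih hkl' hsucc (by omega)
        exact ⟨k', by omega, hpair⟩
      · obtain rfl : l = k + 1 := by omega
        exact absurd (hsucc.trans hg.symm) (not_agree_top hg' hlt)
    · exact ⟨k, le_rfl, hkl, hpair⟩

end IsTower

end

/-! ### Values of sequences -/

/-- The number `∑ sᵢ q⁻ⁱ` represented by the sequence `s` in base `q`; it is `0` if the series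
diverges. -/
noncomputable def val (q : ℝ) (s : ℕ → ℕ) : ℝ := ∑' i, (s i : ℝ) / q ^ (i + 1)

section Val

variable {m d : ℕ} {q q' x : ℝ} {s t b c g : ℕ → ℕ}

theorem hasSum_const_digit (hq : 1 < q) (m : ℕ) :
    HasSum (fun i : ℕ => (m : ℝ) / q ^ (i + 1)) (m / (q - 1)) := by
  have hgeom := (hasSum_geometric_of_lt_one (r := q⁻¹) (by positivity)
    (inv_lt_one_of_one_lt₀ hq)).mul_left ((m : ℝ) / q)
  have hq1 : q - 1 ≠ 0 := by linarith
  have hlim : (m : ℝ) / q * (1 - q⁻¹)⁻¹ = m / (q - 1) := by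
    have : 1 - q⁻¹ = (q - 1) / q := by field_simp
    rw [this]
    field_simp
  rw [hlim] at hgeom
  refine hgeom.congr_fun fun i => ?_
  rw [inv_pow, pow_succ]
  field_simp

theorem summable_digits (hq : 1 < q) (hs : ∀ i, s i ≤ m) :
    Summable (fun i => (s i : ℝ) / q ^ (i + 1)) := by
  refine Summable.of_nonneg_of_le (fun i => by positivity) (fun i => ?_)
    (hasSum_const_digit hq m).summable
  have := hs i
  gcongr

theorem isExpansion_iff (hq : 1 < q) : IsExpansion m q x s ↔ (∀ i, s i ≤ m) ∧ val q s = x :=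
  and_congr_right fun hs => (summable_digits hq hs).hasSum_iff

theorem val_nonneg (hq : 1 < q) : 0 ≤ val q s := tsum_nonneg fun i => by positivity

theorem val_le (hq : 1 < q) (hs : ∀ i, s i ≤ m) : val q s ≤ m / (q - 1) := by
  refine hasSum_le (fun i => ?_) (summable_digits hq hs).hasSum (hasSum_const_digit hq m)
  have := hs i
  gcongr

theorem IsExpansion.base_le (h : IsExpansion m q 1 c) (hq : 1 < q) : q ≤ m + 1 := by
  obtain ⟨hcm, hv⟩ := (isExpansion_iff hq).mp h
  have hle := val_le hq hcm
  rw [hv, le_div_iff₀ (by linarith)] at hle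
  linarith

theorem val_zero (q : ℝ) : val q (fun _ => 0) = 0 := by simp [val]

theorem val_reflectSeq (hq : 1 < q) (hs : ∀ i, s i ≤ m) :
    val q (reflectSeq m s) = m / (q - 1) - val q s := by
  refine HasSum.tsum_eq ?_
  refine ((hasSum_const_digit hq m).sub (summable_digits hq hs).hasSum).congr_fun fun i => ?_
  rw [reflectSeq, Nat.cast_sub (hs i), sub_div]

theorem val_eq_sum_add (hq : 1 < q) (hs : ∀ i, s i ≤ m) (k : ℕ) :
    val q s = ∑ i ∈ Finset.range k, (s i : ℝ) / q ^ (i + 1) + val q (shift k s) / q ^ k := by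
  rw [val, ← (summable_digits hq hs).sum_add_tsum_nat_add k, val, ← tsum_div_const]
  congr 2
  funext i
  rw [shift, add_comm k i, div_div]
  congr 1
  ring

theorem val_sub_mul (hq : 1 < q) (hs : ∀ i, s i ≤ m) (ht : ∀ i, t i ≤ m) (h : Agree d s t) :
    (val q s - val q t) * q ^ (d + 1) =
      s d - t d + (val q (shift (d + 1) s) - val q (shift (d + 1) t)) := by
  rw [val_eq_sum_add hq hs (d + 1), val_eq_sum_add hq ht (d + 1), Finset.sum_range_succ,
    Finset.sum_range_succ, Finset.sum_congr rfl fun i hi => by rw [h i (Finset.mem_range.mp hi)]]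
  have : q ≠ 0 := by positivity
  field_simp
  ring

theorem val_sub_mul_le (hq : 1 < q) (hs : ∀ i, s i ≤ m) (ht : ∀ i, t i ≤ m) (h : Agree d s t)
    (hlt : s d < t d) :
    (val q s - val q t) * q ^ (d + 1) ≤
      val q (shift (d + 1) s) - 1 - val q (shift (d + 1) t) := by
  have hlt' : (s d : ℝ) + 1 ≤ t d := by exact_mod_cast hlt
  rw [val_sub_mul hq hs ht h]
  linarith

theorem val_pos (hq : 1 < q) (hs : ∀ i, s i ≤ m) {i : ℕ} (hi : 0 < s i) : 0 < val q s :=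
  (summable_digits hq hs).tsum_pos (fun i => by positivity) i (by positivity)

theorem val_mono_base (hq : 1 < q) (hqq : q ≤ q') (hs : ∀ i, s i ≤ m) :
    val q' s ≤ val q s := by
  refine (summable_digits (hq.trans_le hqq) hs).tsum_le_tsum (fun i => ?_) (summable_digits hq hs)
  gcongr

theorem val_lt_of_base_lt (hq : 1 < q) (hqq : q < q') (hs : ∀ i, s i ≤ m) {i : ℕ}
    (hi : 0 < s i) : val q' s < val q s := by
  refine (summable_digits (hq.trans hqq) hs).tsum_lt_tsum (i := i)
    (fun i => div_le_div_of_nonneg_left (by positivity) (by positivity) ?_)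
    (div_lt_div_of_pos_left (by positivity) (by positivity) ?_) (summable_digits hq hs)
  · gcongr
  · gcongr

theorem val_eq_of_remainders (hq : 1 < q) (hc : ∀ i, c i ≤ m) {r : ℕ → ℝ} {C : ℝ}
    (hr : ∀ k, r k ∈ Icc 0 C) (hstep : ∀ k, r (k + 1) = q * r k - c k) : val q c = r 0 := by
  have hsum : ∀ k, ∑ i ∈ Finset.range k, (c i : ℝ) / q ^ (i + 1) = r 0 - r k / q ^ k := by
    intro k
    induction k with
    | zero => simp
    | succ k ih =>
      rw [Finset.sum_range_succ, ih, hstep]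
      field_simp
      ring
  have hlim : Filter.Tendsto (fun k => r k / q ^ k) Filter.atTop (nhds 0) :=
    squeeze_zero (fun k => div_nonneg (hr k).1 (by positivity))
      (fun k => div_le_div_of_nonneg_right (hr k).2 (by positivity))
      ((tendsto_pow_atTop_atTop_of_one_lt hq).const_div_atTop C)
  refine tendsto_nhds_unique (summable_digits hq hc).hasSum.tendsto_sum_nat ?_
  simpa only [hsum, sub_zero] using hlim.const_sub (r 0)

theorem exists_digit (hq : 1 < q) (hqm : q ≤ m + 1) {y : ℝ} (hy : y ∈ Ioc 0 (m / (q - 1))) :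
    ∃ d ≤ m, q * y - d ∈ Ioc 0 (m / (q - 1)) := by
  have hq1 : 0 < q - 1 := by linarith
  have hqy : 0 < q * y := mul_pos (by linarith) hy.1
  have hceil : (((⌈q * y⌉₊ - 1 : ℕ)) : ℝ) = ⌈q * y⌉₊ - 1 := by
    rw [Nat.cast_sub (Nat.ceil_pos.mpr hqy), Nat.cast_one]
  have hlt := Nat.ceil_lt_add_one hqy.le
  rcases le_total m (⌈q * y⌉₊ - 1) with h | h
  · have h' : (m : ℝ) ≤ (⌈q * y⌉₊ - 1 : ℕ) := by exact_mod_cast h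
    have hmul : q * y ≤ q * (m / (q - 1)) := by gcongr; exact hy.2
    have hfix : q * ((m : ℝ) / (q - 1)) - m = m / (q - 1) := by field_simp; ring
    exact ⟨m, le_rfl, by linarith, by linarith⟩
  · have h1 : 1 ≤ (m : ℝ) / (q - 1) := by rw [le_div_iff₀ hq1]; linarith
    have hle := Nat.le_ceil (q * y)
    exact ⟨_, h, by linarith, by linarith⟩

theorem exists_infinite_expansion (hq : 1 < q) (hqm : q ≤ m + 1) {y : ℝ}
    (hy : y ∈ Ioc 0 (m / (q - 1))) :
    ∃ c : ℕ → ℕ, (∀ i, c i ≤ m) ∧ IsInfiniteSeq c ∧ val q c = y := by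
  choose! D hD hD' using fun y (hy : y ∈ Ioc 0 (m / (q - 1))) => exists_digit hq hqm hy
  set r : ℕ → ℝ := fun k => (fun z => q * z - D z)^[k] y
  have hstep : ∀ k, r (k + 1) = q * r k - D (r k) := fun k => Function.iterate_succ_apply' _ k y
  have hmem : ∀ k, r k ∈ Ioc 0 (m / (q - 1)) := by
    intro k
    induction k with
    | zero => exact hy
    | succ k ih => rw [hstep]; exact hD' _ ih
  have hval : ∀ k, val q (shift k fun i => D (r i)) = r k := fun k =>
    val_eq_of_remainders (r := fun i => r (k + i)) hq (fun i => hD _ (hmem (k + i)))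
      (fun i => Ioc_subset_Icc_self (hmem (k + i))) fun i => hstep (k + i)
  refine ⟨fun i => D (r i), fun i => hD _ (hmem i), ?_,
    (congrArg (val q) (shift_zero _)).symm.trans (hval 0)⟩
  rintro ⟨N, -, hN⟩
  have hzero : shift (N + 1) (fun i => D (r i)) = fun _ => 0 := funext fun i => hN _ (by omega)
  have := hval (N + 1)
  rw [hzero, val_zero] at this
  exact (hmem (N + 1)).1.ne this

/-- The sequence `s₀ ⋯ s_{k-1} (s_k + 1) c₀ c₁ ⋯`. -/
def raise (s : ℕ → ℕ) (k : ℕ) (c : ℕ → ℕ) : ℕ → ℕ :=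
  fun i => if i < k then s i else if i = k then s k + 1 else c (i - (k + 1))

theorem agree_raise (s : ℕ → ℕ) (k : ℕ) (c : ℕ → ℕ) : Agree k (raise s k c) s :=
  fun _ hi => if_pos hi

theorem raise_self (s : ℕ → ℕ) (k : ℕ) (c : ℕ → ℕ) : raise s k c k = s k + 1 := by simp [raise]

theorem shift_raise (s : ℕ → ℕ) (k : ℕ) (c : ℕ → ℕ) : shift (k + 1) (raise s k c) = c := by
  funext i
  simp only [shift, raise]
  rw [if_neg (by omega), if_neg (by omega), Nat.add_sub_cancel_left]

theorem raise_le {k : ℕ} (hs : ∀ i, s i ≤ m) (hk : s k < m) (hc : ∀ i, c i ≤ m) (i : ℕ) :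
    raise s k c i ≤ m := by
  simp only [raise]
  split_ifs
  exacts [hs i, hk, hc _]

theorem val_raise {k : ℕ} (hq : 1 < q) (hs : ∀ i, s i ≤ m) (hk : s k < m) (hc : ∀ i, c i ≤ m)
    (h : val q c = val q (shift (k + 1) s) - 1) : val q (raise s k c) = val q s := by
  have hdiff := val_sub_mul hq (raise_le hs hk hc) hs (agree_raise s k c)
  rw [shift_raise, raise_self, h] at hdiff
  have hzero : (val q (raise s k c) - val q s) * q ^ (k + 1) = 0 := by
    rw [hdiff]; push_cast; ring
  exact sub_eq_zero.mp ((mul_eq_zero.mp hzero).resolve_right (by positivity))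

/-! ### Unique expansions -/

/-- The condition on the values of the tails that characterizes the unique expansions `b`:
no digit can be raised (first clause) or lowered (second clause). -/
def IsUnivoque (m : ℕ) (q : ℝ) (b : ℕ → ℕ) : Prop :=
  (∀ i, b i ≤ m) ∧ ∀ i, (b i < m → val q (shift (i + 1) b) < 1) ∧
    (0 < b i → val q (reflectSeq m (shift (i + 1) b)) < 1)

theorem IsUnivoque.reflectSeq (h : IsUnivoque m q b) : IsUnivoque m q (reflectSeq m b) := by
  refine ⟨reflectSeq_le m b, fun i => ⟨fun hi => ?_, fun hi => ?_⟩⟩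
  · rw [shift_reflectSeq]
    exact (h.2 i).2 (by simp only [UniqueExpansion.reflectSeq] at hi; omega)
  · rw [shift_reflectSeq, reflectSeq_reflectSeq_shift h.1]
    exact (h.2 i).1 (by simp only [UniqueExpansion.reflectSeq] at hi; omega)

theorem IsUnivoque.not_lex_lt_of_val_eq (hq : 1 < q) (h : IsUnivoque m q b) (hc : ∀ i, c i ≤ m)
    (hv : val q c = val q b) : ¬ toLex b < toLex c := by
  rintro ⟨d, hag, hlt⟩
  have hdiff := val_sub_mul_le hq h.1 hc hag hlt
  rw [hv, sub_self, zero_mul] at hdiff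
  have hlt_one := (h.2 d).1 (hlt.trans_le (hc d))
  have hnonneg := val_nonneg (s := shift (d + 1) c) hq
  linarith

theorem IsUnivoque.eq_of_val_eq (hq : 1 < q) (h : IsUnivoque m q b) (hc : ∀ i, c i ≤ m)
    (hv : val q c = val q b) : c = b := by
  rcases lt_trichotomy (toLex c) (toLex b) with hlt | heq | hgt
  · refine (h.reflectSeq.not_lex_lt_of_val_eq hq (reflectSeq_le m c) ?_
      (reflectSeq_lex_lt hlt h.1)).elim
    rw [val_reflectSeq hq hc, val_reflectSeq hq h.1, hv]
  · exact toLex.injective heq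
  · exact (h.not_lex_lt_of_val_eq hq hc hv hgt).elim

theorem val_shift_lt_one_of_forall_eq (hq : 1 < q) (hqm : q ≤ m + 1) (hb : ∀ i, b i ≤ m)
    (huniq : ∀ d, (∀ i, d i ≤ m) → val q d = val q b → d = b) {i : ℕ} (hi : b i < m) :
    val q (shift (i + 1) b) < 1 := by
  by_contra! hle
  obtain ⟨c, hc, hcv⟩ : ∃ c : ℕ → ℕ, (∀ j, c j ≤ m) ∧ val q c = val q (shift (i + 1) b) - 1 := by
    rcases hle.eq_or_lt with heq | hlt
    · exact ⟨fun _ => 0, fun _ => Nat.zero_le m, by rw [val_zero, ← heq, sub_self]⟩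
    · have hvle := val_le (s := shift (i + 1) b) hq fun _ => hb _
      obtain ⟨c, hc, -, hcv⟩ := exists_infinite_expansion (m := m) hq hqm
        (y := val q (shift (i + 1) b) - 1) ⟨by linarith, by linarith⟩
      exact ⟨c, hc, hcv⟩
  have hraise := congrFun (huniq _ (raise_le hb hi hc) (val_raise hq hb hi hc hcv)) i
  rw [raise_self] at hraise
  omega

theorem mem_univoqueSeqs_iff (hq : 1 < q) (hqm : q ≤ m + 1) :
    b ∈ univoqueSeqs m q ↔ IsUnivoque m q b := by
  constructor
  · rintro ⟨x, ⟨-, c, -, hc⟩, hb⟩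
    have huniq : ∀ d, (∀ i, d i ≤ m) → val q d = val q b → d = b := fun d hd hv => by
      rw [hc b hb]
      exact hc d ((isExpansion_iff hq).mpr ⟨hd, hv.trans ((isExpansion_iff hq).mp hb).2⟩)
    refine ⟨hb.1, fun i => ⟨val_shift_lt_one_of_forall_eq hq hqm hb.1 huniq, fun hi => ?_⟩⟩
    rw [← shift_reflectSeq]
    refine val_shift_lt_one_of_forall_eq hq hqm (reflectSeq_le m b) (fun d hd hv => ?_) ?_
    · rw [← huniq (reflectSeq m d) (reflectSeq_le m d) (by
        rw [val_reflectSeq hq hd, hv, val_reflectSeq hq hb.1, sub_sub_cancel]),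
        reflectSeq_reflectSeq hd]
    · have := hb.1 i
      simp only [reflectSeq]
      omega
  · intro h
    refine ⟨val q b, ⟨⟨val_nonneg hq, val_le hq h.1⟩, b, (isExpansion_iff hq).mpr ⟨h.1, rfl⟩,
      fun c hc => ?_⟩, (isExpansion_iff hq).mpr ⟨h.1, rfl⟩⟩
    obtain ⟨hcm, hcv⟩ := (isExpansion_iff hq).mp hc
    exact h.eq_of_val_eq hq hcm hcv

theorem IsUnivoque.mono_base (hq : 1 < q) (hqq : q ≤ q') (h : IsUnivoque m q b) :
    IsUnivoque m q' b :=
  ⟨h.1, fun i => ⟨fun hi => (val_mono_base hq hqq fun _ => h.1 _).trans_lt ((h.2 i).1 hi),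
    fun hi => (val_mono_base hq hqq (reflectSeq_le m _)).trans_lt ((h.2 i).2 hi)⟩⟩

/-! ### Lexicographic bounds and bounds on values -/

theorem val_shift_le_one_add_div (hq : 1 < q) (hb : ∀ i, b i ≤ m) (hg : ∀ i, g i ≤ m)
    (hv : val q g ≤ 1) (h : ∀ i, b i < m → toLex (shift (i + 1) b) ≤ toLex g) {C : ℝ}
    (hC : 0 ≤ C) (hbC : ∀ K, toLex (shift K b) ≤ toLex g → val q (shift K b) ≤ 1 + C) {K : ℕ}
    (hK : toLex (shift K b) ≤ toLex g) : val q (shift K b) ≤ 1 + C / q := by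
  have : 0 < q := by linarith
  rcases hK.lt_or_eq with ⟨d, hag, hlt⟩ | heq
  · have hdiff := val_sub_mul_le hq (s := shift K b) (fun i => hb _) hg hag hlt
    have hnext := hbC (K + d + 1) (h _ (hlt.trans_le (hg d)))
    rw [shift_shift, ← add_assoc] at hdiff
    have hnonneg := val_nonneg (s := shift (d + 1) g) hq
    have hpow : q ≤ q ^ (d + 1) := le_self_pow₀ hq.le (by omega)
    have : val q (shift K b) - val q g ≤ C / q := calc
      val q (shift K b) - val q g ≤ C / q ^ (d + 1) := by
        rw [le_div_iff₀ (by positivity)]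
        linarith
      _ ≤ C / q := by gcongr
    linarith
  · rw [toLex.injective heq]
    have : 0 ≤ C / q := by positivity
    linarith

theorem val_shift_le_one (hq : 1 < q) (hb : ∀ i, b i ≤ m) (hg : ∀ i, g i ≤ m)
    (hv : val q g ≤ 1) (h : ∀ i, b i < m → toLex (shift (i + 1) b) ≤ toLex g) {K : ℕ}
    (hK : toLex (shift K b) ≤ toLex g) : val q (shift K b) ≤ 1 := by
  have : 0 ≤ (m : ℝ) / (q - 1) := div_nonneg (by positivity) (by linarith)
  have hbound : ∀ n K, toLex (shift K b) ≤ toLex g →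
      val q (shift K b) ≤ 1 + m / (q - 1) / q ^ n := by
    intro n
    induction n with
    | zero =>
      intro K _
      have := val_le (s := shift K b) hq fun i => hb _
      rw [pow_zero, div_one]
      linarith
    | succ n ih =>
      intro K hK
      rw [pow_succ, ← div_div]
      exact val_shift_le_one_add_div hq hb hg hv h (by positivity) ih hK
  have hlim : Filter.Tendsto (fun n : ℕ => 1 + (m : ℝ) / (q - 1) / q ^ n) Filter.atTop
      (nhds 1) := by
    simpa only [add_zero] using ((tendsto_pow_atTop_atTop_of_one_lt hq).const_div_atTop
      ((m : ℝ) / (q - 1))).const_add 1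
  exact ge_of_tendsto' hlim fun n => hbound n K hK

theorem val_shift_lt_one (hq : 1 < q) (hb : ∀ i, b i ≤ m) (hg : ∀ i, g i ≤ m)
    (hv : val q g ≤ 1) (hv' : val q g < 1 ∨ ∀ k, 0 < val q (shift k g))
    (h : ∀ i, b i < m → toLex (shift (i + 1) b) ≤ toLex g) {K : ℕ}
    (hK : toLex (shift K b) < toLex g) : val q (shift K b) < 1 := by
  obtain ⟨d, hag, hlt⟩ := hK
  have hdiff := val_sub_mul_le hq (s := shift K b) (fun i => hb _) hg hag hlt
  have hnext := val_shift_le_one hq hb hg hv h (h (K + d) (hlt.trans_le (hg d)))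
  rw [shift_shift, ← add_assoc] at hdiff
  have hqd : 0 < q ^ (d + 1) := by positivity
  rcases hv' with hv1 | hpos
  · have hnonneg := val_nonneg (s := shift (d + 1) g) hq
    have := nonpos_of_mul_nonpos_left (hdiff.trans (by linarith)) hqd
    linarith
  · have := neg_of_mul_neg_left (hdiff.trans_lt (by linarith [hpos (d + 1)])) hqd.le
    linarith

/-- The lexicographic counterpart of `IsUnivoque`: every tail of `b` that follows a digit `< m`,
and the reflection of every tail that follows a digit `> 0`, is smaller than `g`. -/
def LexBounded (m : ℕ) (g b : ℕ → ℕ) : Prop :=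
  (∀ i, b i ≤ m) ∧ ∀ i, (b i < m → toLex (shift (i + 1) b) < toLex g) ∧
    (0 < b i → toLex (reflectSeq m (shift (i + 1) b)) < toLex g)

theorem LexBounded.reflectSeq (h : LexBounded m g b) : LexBounded m g (reflectSeq m b) := by
  refine ⟨reflectSeq_le m b, fun i => ⟨fun hi => ?_, fun hi => ?_⟩⟩
  · rw [shift_reflectSeq]
    exact (h.2 i).2 (by simp only [UniqueExpansion.reflectSeq] at hi; omega)
  · rw [shift_reflectSeq, reflectSeq_reflectSeq_shift h.1]
    exact (h.2 i).1 (by simp only [UniqueExpansion.reflectSeq] at hi; omega)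

theorem LexBounded.isUnivoque (hq : 1 < q) (hg : ∀ i, g i ≤ m) (hv : val q g ≤ 1)
    (hv' : val q g < 1 ∨ ∀ k, 0 < val q (shift k g)) (h : LexBounded m g b) :
    IsUnivoque m q b := by
  have hlt : ∀ {b}, LexBounded m g b → ∀ i, b i < m → val q (shift (i + 1) b) < 1 :=
    fun h i hi => val_shift_lt_one hq h.1 hg hv hv' (fun i hi => ((h.2 i).1 hi).le) ((h.2 i).1 hi)
  refine ⟨h.1, fun i => ⟨hlt h i, fun hi => ?_⟩⟩
  rw [← shift_reflectSeq]
  refine hlt h.reflectSeq i ?_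
  have := h.1 i
  simp only [UniqueExpansion.reflectSeq]
  omega

theorem one_le_val_of_lex_le (hq : 1 < q) (hg : ∀ i, g i ≤ m) (hs : ∀ i, s i ≤ m)
    (hv : val q g = 1) (hsh : ∀ k, toLex (shift k g) ≤ toLex g) (h : toLex g ≤ toLex s) :
    1 ≤ val q s := by
  rcases h.lt_or_eq with ⟨d, hag, hlt⟩ | heq
  · have hdiff := val_sub_mul_le hq hg hs hag hlt
    have htail := val_shift_le_one hq hg hg hv.le (fun i _ => hsh _) (hsh (d + 1))
    have hnonneg := val_nonneg (s := shift (d + 1) s) hq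
    have := nonpos_of_mul_nonpos_left (hdiff.trans (by linarith)) (by positivity : 0 < q ^ (d + 1))
    linarith
  · rw [← toLex.injective heq, hv]

theorem IsUnivoque.lexBounded (hq : 1 < q) (hg : ∀ i, g i ≤ m) (hv : val q g = 1)
    (hsh : ∀ k, toLex (shift k g) ≤ toLex g) (hb : IsUnivoque m q b) : LexBounded m g b := by
  have hlt : ∀ {s}, (∀ i, s i ≤ m) → val q s < 1 → toLex s < toLex g := fun hs hvs =>
    lt_of_not_ge fun hle => hvs.not_ge (one_le_val_of_lex_le hq hg hs hv hsh hle)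
  exact ⟨hb.1, fun i => ⟨fun hi => hlt (fun _ => hb.1 _) ((hb.2 i).1 hi),
    fun hi => hlt (reflectSeq_le m _) ((hb.2 i).2 hi)⟩⟩

theorem val_eq_one_of_isPlus {N : ℕ} (hq : 1 < q) (hc : ∀ i, c i ≤ m) (hg : ∀ i, g i ≤ m)
    (hv : val q c = 1) (hc0 : shift N c = fun _ => 0) (hper : shift N g = g)
    (hplus : IsPlus N g c) : val q g = 1 := by
  obtain ⟨d, rfl, hag, hlast⟩ := hplus
  have hdiff := val_sub_mul hq hg hc hag
  rw [hc0, val_zero, hper, hv, hlast] at hdiff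
  have hpow : 1 < q ^ (d + 1) := one_lt_pow₀ hq (by omega)
  have hmul : (val q g - 1) * (q ^ (d + 1) - 1) = 0 := by
    push_cast at hdiff
    linear_combination hdiff
  exact sub_eq_zero.mp ((mul_eq_zero.mp hmul).resolve_right (by linarith))

end Val

/-! ### Quasi-greedy expansions -/

section QuasiGreedy

variable {m j : ℕ} {q u q₀ q₀' : ℝ} {A c g : ℕ → ℕ}

theorem IsInfiniteSeq.exists_ge_ne_zero (hc : IsInfiniteSeq c) (h : ∃ i, c i ≠ 0) (k : ℕ) :
    ∃ i, k ≤ i ∧ c i ≠ 0 := by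
  induction k with
  | zero => simpa using h
  | succ k ih =>
    obtain ⟨N, hkN, hN⟩ := ih
    by_contra! hzero
    exact hc ⟨N, hN, fun i hi => hzero i (by omega)⟩

theorem IsQuasiGreedy.val_shift_pos (hA : IsQuasiGreedy m q 1 A) (hq : 1 < q) (k : ℕ) :
    0 < val q (shift k A) := by
  obtain ⟨hAm, hv⟩ := (isExpansion_iff hq).mp hA.1
  have hne : ∃ i, A i ≠ 0 := by
    by_contra! hzero
    rw [funext hzero, val_zero] at hv
    exact zero_ne_one hv
  obtain ⟨i, hki, hi⟩ := hA.2.1.exists_ge_ne_zero hne k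
  obtain ⟨e, rfl⟩ := Nat.exists_eq_add_of_le hki
  exact val_pos hq (fun _ => hAm _) (Nat.pos_of_ne_zero hi)

theorem IsInfiniteSeq.raise (hc : IsInfiniteSeq c) (h : ∃ i, c i ≠ 0) (k : ℕ) :
    IsInfiniteSeq (raise A k c) := by
  rintro ⟨N, -, hN⟩
  obtain ⟨i, hi, hne⟩ := hc.exists_ge_ne_zero h N
  refine hne ?_
  rw [← shift_raise A k c]
  exact hN _ (by omega)

theorem IsQuasiGreedy.val_shift_le_one (hA : IsQuasiGreedy m q 1 A) (hq : 1 < q)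
    (hqm : q ≤ m + 1) {k : ℕ} (hk : A k < m) : val q (shift (k + 1) A) ≤ 1 := by
  obtain ⟨hAm, hv⟩ := (isExpansion_iff hq).mp hA.1
  by_contra! hlt
  have hle := val_le (s := shift (k + 1) A) hq fun i => hAm _
  obtain ⟨c, hcm, hcinf, hcv⟩ := exists_infinite_expansion (m := m) hq hqm
    (y := val q (shift (k + 1) A) - 1) ⟨by linarith, by linarith⟩
  have hne : ∃ i, c i ≠ 0 := by
    by_contra! hzero
    rw [funext hzero, val_zero] at hcv
    linarith
  refine (hA.2.2 _ ((isExpansion_iff hq).mpr ⟨raise_le hAm hk hcm,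
    (val_raise hq hAm hk hcm hcv).trans hv⟩) (hcinf.raise hne k)).not_gt ?_
  exact LtUpTo.lex_lt ⟨k, Nat.lt_succ_self k, (agree_raise A k c).symm, by rw [raise_self]; omega⟩

theorem IsQuasiGreedy.lex_shift_le (hA : IsQuasiGreedy m q 1 A) (hq : 1 < q) (hqm : q ≤ m + 1)
    (k : ℕ) : toLex (shift k A) ≤ toLex A := by
  obtain ⟨hAm, hv⟩ := (isExpansion_iff hq).mp hA.1
  refine lex_shift_le_self_of_forall hAm (fun i hi => le_of_not_gt ?_) k
  rintro ⟨d, hag, hlt⟩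
  have hdiff := val_sub_mul_le hq hAm (t := shift (i + 1) A) (fun i => hAm _) hag hlt
  have htail := hA.val_shift_le_one hq hqm hi
  have htail' := hA.val_shift_le_one hq hqm (hlt.trans_le (hAm _))
  have hpos := hA.val_shift_pos hq (i + 1 + (d + 1))
  rw [shift_shift, hv] at hdiff
  have : 0 ≤ (1 - val q (shift (i + 1) A)) * q ^ (d + 1) :=
    mul_nonneg (by linarith) (by positivity)
  linarith

theorem IsQuasiGreedy.lt_head (hA : IsQuasiGreedy m q 1 A) (hm : 1 ≤ m) (hqm : q ≤ m + 1)
    (hq : ((m / 2 + 1 : ℕ) : ℝ) < q) : m - A 0 < A 0 := by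
  have hq1 : 1 < q := lt_of_le_of_lt (by exact_mod_cast Nat.le_add_left 1 _) hq
  obtain ⟨hAm, hv⟩ := (isExpansion_iff hq1).mp hA.1
  by_contra! h
  have hhead : A 0 ≤ m / 2 := by omega
  have htail := hA.val_shift_le_one hq1 hqm (k := 0) (by omega)
  have hsplit := val_eq_sum_add hq1 hAm 1
  have hhead' : (A 0 : ℝ) + 1 ≤ ((m / 2 + 1 : ℕ) : ℝ) := by exact_mod_cast Nat.succ_le_succ hhead
  rw [hv, Finset.sum_range_one, zero_add, pow_one, ← add_div,
    eq_div_iff (by positivity)] at hsplit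
  rw [zero_add] at htail
  linarith

theorem IsQuasiGreedy.one_le_sum_add (hA : IsQuasiGreedy m q 1 A) (hq : 1 < q) (hqm : q ≤ m + 1)
    (hu : 0 < u) (huq : u ≤ q) (hj : A j < m) :
    1 ≤ ∑ i ∈ Finset.range (j + 1), (A i : ℝ) / u ^ (i + 1) + 1 / u ^ (j + 1) := by
  obtain ⟨hAm, hv⟩ := (isExpansion_iff hq).mp hA.1
  have htail := hA.val_shift_le_one hq hqm hj
  calc 1 = ∑ i ∈ Finset.range (j + 1), (A i : ℝ) / q ^ (i + 1) +
        val q (shift (j + 1) A) / q ^ (j + 1) := by rw [← hv, val_eq_sum_add hq hAm (j + 1)]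
    _ ≤ _ := by gcongr

theorem val_eq_sum_add_of_agree (hu : 1 < u) (hg : ∀ i, g i ≤ m) (h : Agree j g A) :
    val u g = ∑ i ∈ Finset.range (j + 1), (A i : ℝ) / u ^ (i + 1) +
      (g j - A j + val u (shift (j + 1) g)) / u ^ (j + 1) := by
  rw [val_eq_sum_add hu hg (j + 1), Finset.sum_range_succ, Finset.sum_range_succ,
    Finset.sum_congr rfl fun i hi => by rw [h i (Finset.mem_range.mp hi)]]
  ring

theorem IsQuasiGreedy.agree_of_sum_lt_one (hA : IsQuasiGreedy m q 1 A) (hq : 1 < q)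
    (hqm : q ≤ m + 1) (hu : 1 < u) (huq : u ≤ q) (hg : IsUnivoque m u g) (hgv : val u g = 1)
    {N : ℕ} (hsum : ∀ j ≤ N, ∑ i ∈ Finset.range j, (A i : ℝ) / u ^ (i + 1) < 1) :
    Agree N g A := by
  intro j hj
  induction j using Nat.strong_induction_on with
  | _ j ih =>
    have hpow : 0 < u ^ (j + 1) := by positivity
    have hval := val_eq_sum_add_of_agree hu hg.1 fun i hi => ih i hi (hi.trans hj)
    rw [hgv] at hval
    rcases lt_trichotomy (g j) (A j) with hlt | heq | hgt
    · have htail := (hg.2 j).1 (hlt.trans_le (((isExpansion_iff hq).mp hA.1).1 j))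
      have hlt' : (g j : ℝ) + 1 ≤ A j := by exact_mod_cast hlt
      have hneg : (g j - A j + val u (shift (j + 1) g)) / u ^ (j + 1) < 0 :=
        div_neg_of_neg_of_pos (by linarith) hpow
      linarith [hsum (j + 1) hj]
    · exact heq
    · have htail := (hg.2 j).2 (by omega)
      rw [val_reflectSeq (s := shift (j + 1) g) hu fun i => hg.1 _] at htail
      have hm1 : 1 ≤ (m : ℝ) / (u - 1) := by
        rw [le_div_iff₀ (by linarith)]
        linarith
      have hgt' : (A j : ℝ) + 1 ≤ g j := by exact_mod_cast hgt
      have hone := hA.one_le_sum_add hq hqm (by linarith) huq (hgt.trans_le (hg.1 j))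
      have hlarge : 1 / u ^ (j + 1) < (g j - A j + val u (shift (j + 1) g)) / u ^ (j + 1) :=
        div_lt_div_of_pos_right (by linarith) hpow
      linarith

theorem IsQuasiGreedy.eventually_sum_lt_one (hA : IsQuasiGreedy m q 1 A) (hq : 1 < q) (j : ℕ) :
    ∀ᶠ u in nhds q, ∑ i ∈ Finset.range j, (A i : ℝ) / u ^ (i + 1) < 1 := by
  obtain ⟨hAm, hv⟩ := (isExpansion_iff hq).mp hA.1
  have hcont : ContinuousAt (fun u : ℝ => ∑ i ∈ Finset.range j, (A i : ℝ) / u ^ (i + 1)) q :=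
    tendsto_finsetSum _ fun i _ => continuousAt_const.div (continuousAt_id.pow _) (by positivity)
  refine hcont.eventually_lt_const ?_
  have hsplit := val_eq_sum_add hq hAm j
  have hpos : 0 < val q (shift j A) / q ^ j := div_pos (hA.val_shift_pos hq j) (by positivity)
  linarith

theorem IsQuasiGreedy.eventually_agree (hA : IsQuasiGreedy m q 1 A) (hq : 1 < q)
    (hqm : q ≤ m + 1) (N : ℕ) :
    ∀ᶠ u in nhds q, u ≤ q → ∀ g, IsUnivoque m u g → val u g = 1 → Agree N g A := by
  have hall : ∀ᶠ u in nhds q, ∀ j ∈ Finset.range (N + 1),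
      ∑ i ∈ Finset.range j, (A i : ℝ) / u ^ (i + 1) < 1 :=
    (Finset.eventually_all _).mpr fun j _ => hA.eventually_sum_lt_one hq j
  filter_upwards [hall, lt_mem_nhds hq] with u hsum hu huq g hg hgv
  exact hA.agree_of_sum_lt_one hq hqm hu huq hg hgv fun j hj =>
    hsum j (Finset.mem_range.mpr (by omega))

theorem IsUnivoque.reflectSeq_lex_shift_le (hu : 1 < u) (hg : IsUnivoque m u g)
    (hgv : val u g = 1) {i : ℕ} (hi : 0 < g i) :
    toLex (UniqueExpansion.reflectSeq m (shift (i + 1) g)) ≤ toLex g := by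
  refine le_of_not_gt ?_
  rintro ⟨d, hag, hlt⟩
  have hdiff := val_sub_mul_le hu hg.1 (reflectSeq_le m _) hag hlt
  have htail := (hg.2 d).1 (hlt.trans_le (reflectSeq_le m _ d))
  have hnonneg := val_nonneg
    (s := shift (d + 1) (UniqueExpansion.reflectSeq m (shift (i + 1) g))) hu
  have hneg := neg_of_mul_neg_left (hdiff.trans_lt (by linarith))
    (by positivity : 0 ≤ u ^ (d + 1))
  have := (hg.2 i).2 hi
  linarith

theorem IsQuasiGreedy.reflectSeq_lex_shift_le (hA : IsQuasiGreedy m q 1 A) (hq : 1 < q)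
    (hqm : q ≤ m + 1) (h0 : m - A 0 < A 0)
    (hU : ∃ᶠ u in nhds q, u ≤ q ∧ u ∈ univoqueBases m) (k : ℕ) :
    toLex (reflectSeq m (shift k A)) ≤ toLex A := by
  refine reflectSeq_lex_shift_le_of_forall ((isExpansion_iff hq).mp hA.1).1
    (LtUpTo.lex_lt ⟨0, Nat.one_pos, fun _ h => absurd h (Nat.not_lt_zero _), h0⟩).le
    (fun i hi => le_of_not_gt fun hlt => ?_) k
  obtain ⟨n, hn⟩ := lex_lt_iff_exists_ltUpTo.mp hlt
  obtain ⟨u, ⟨huq, ⟨hu, hum⟩, huU⟩, hagree⟩ :=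
    (hU.and_eventually (hA.eventually_agree hq hqm (i + 1 + n))).exists
  obtain ⟨g, hg, -⟩ := huU.2
  have hgu : IsUnivoque m u g := (mem_univoqueSeqs_iff hu hum).mp ⟨1, huU, hg⟩
  have hgv := ((isExpansion_iff hu).mp hg).2
  have hgA := (hagree huq g hgu hgv).symm
  refine (hgu.reflectSeq_lex_shift_le hu hgv ?_).not_gt
    (hn.congr (hgA.mono (by omega)) hgA.shift.reflectSeq).lex_lt
  rw [← hgA i (by omega)]
  exact hi

theorem lt_of_periodic_of_base_lt (hq : 1 < q) (hqm : q < m + 1) (hA : ∀ i, A i ≤ m)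
    (hv : val q A = 1) (hsh : ∀ k, toLex (shift k A) ≤ toLex A) (hper : shift (k + 1) A = A) :
    A k < m := by
  by_contra! hk
  have hkm : A k = m := (hA k).antisymm hk
  have h0 : A 0 = m := (hA 0).antisymm (hkm ▸ lex_le_head (hsh k))
  have hconst : shift 1 A = A := by
    have hle := lex_le_shift (k := 1) (fun i hi => ?_) (hsh k)
    · rw [shift_shift, hper] at hle
      exact toLex.injective ((hsh 1).antisymm hle)
    · rw [Nat.lt_one_iff.mp hi, h0]
      exact hkm
  have hsplit := val_eq_sum_add hq hA 1
  rw [hconst, hv, Finset.sum_range_one, h0, zero_add, pow_one, ← add_div,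
    eq_div_iff (by positivity)] at hsplit
  linarith

theorem IsComponent.lt (h : IsComponent m q₀ q₀') : q₀ < m + 1 := by
  obtain ⟨x, hx, hc⟩ := h
  have hmem := mem_connectedComponentIn hx
  rw [hc] at hmem
  exact hmem.1.trans_le hx.1.2

theorem IsComponent.mem_closure (h : IsComponent m q₀ q₀')
    (hq₀ : ((m / 2 + 1 : ℕ) : ℝ) < q₀) : q₀ ∈ closure (univoqueBases m) := by
  have hlt := h.lt
  obtain ⟨x, hx, hc⟩ := h
  set S := Ioc ((m / 2 + 1 : ℕ) : ℝ) (m + 1) \ closure (univoqueBases m)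
  have hxI : x ∈ Ioo q₀ q₀' := hc ▸ mem_connectedComponentIn hx
  by_contra hn
  have hsub : Ico q₀ q₀' ⊆ S := by
    intro y hy
    rcases hy.1.eq_or_lt with rfl | hlt'
    · exact ⟨⟨hq₀, hlt.le⟩, hn⟩
    · exact connectedComponentIn_subset S x (hc ▸ ⟨hlt', hy.2⟩)
  have hcomp := isPreconnected_Ico.subset_connectedComponentIn (Ioo_subset_Ico_self hxI) hsub
  rw [hc] at hcomp
  exact lt_irrefl _ (hcomp ⟨le_rfl, hxI.1.trans hxI.2⟩).1

theorem IsComponent.frequently_mem (h : IsComponent m q₀ q₀')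
    (hq₀ : ((m / 2 + 1 : ℕ) : ℝ) < q₀) : ∃ᶠ u in nhds q₀, u ≤ q₀ ∧ u ∈ univoqueBases m := by
  have hcl := h.mem_closure hq₀
  obtain ⟨x, hx, hc⟩ := h
  have hxI : x ∈ Ioo q₀ q₀' := hc ▸ mem_connectedComponentIn hx
  refine ((mem_closure_iff_frequently.mp hcl).and_eventually
    (gt_mem_nhds (hxI.1.trans hxI.2))).mono fun u ⟨huU, hu⟩ => ⟨le_of_not_gt fun hlt => ?_, huU⟩
  have hmem : u ∈ Ioo q₀ q₀' := ⟨hlt, hu⟩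
  rw [← hc] at hmem
  exact (connectedComponentIn_subset _ _ hmem).2 (subset_closure huU)

end QuasiGreedy

/-! ### Words and sequences -/

/-- The word formed by the first `N` digits of `s`. -/
def prefixWord (N : ℕ) (s : ℕ → ℕ) : List ℕ := (List.range N).map s

section

variable {m i k l N n : ℕ} {w a : List ℕ} {s t : ℕ → ℕ}

theorem length_prefixWord (N : ℕ) (s : ℕ → ℕ) : (prefixWord N s).length = N := by
  simp [prefixWord]

theorem getElem_prefixWord (h : i < (prefixWord N s).length) : (prefixWord N s)[i] = s i := by
  simp [prefixWord]

theorem prefixWord_eq_iff : prefixWord N s = w ↔ w.length = N ∧ ∀ i < N, w.getD i 0 = s i := by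
  constructor
  · rintro rfl
    refine ⟨length_prefixWord N s, fun i hi => ?_⟩
    rw [List.getD_eq_getElem _ _ (by rwa [length_prefixWord]), getElem_prefixWord]
  · rintro ⟨rfl, h⟩
    refine List.ext_getElem (length_prefixWord _ _) fun i _ hi => ?_
    rw [getElem_prefixWord, ← h i hi, List.getD_eq_getElem]

theorem prefixWord_eq_prefixWord_iff : prefixWord N s = prefixWord N t ↔ Agree N s t := by
  simp [prefixWord, Agree]

theorem prefixWord_add (N P : ℕ) (s : ℕ → ℕ) :
    prefixWord (N + P) s = prefixWord N s ++ prefixWord P (shift N s) := by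
  simp [prefixWord, List.range_add, shift, Function.comp_def]

theorem prefixWord_succ (N : ℕ) (s : ℕ → ℕ) : prefixWord (N + 1) s = prefixWord N s ++ [s N] :=
  prefixWord_add N 1 s

theorem take_prefixWord (h : k ≤ N) (s : ℕ → ℕ) : (prefixWord N s).take k = prefixWord k s := by
  obtain ⟨e, rfl⟩ := Nat.exists_eq_add_of_le h
  rw [prefixWord_add, List.take_left' (length_prefixWord k s)]

theorem drop_prefixWord (h : k ≤ N) (s : ℕ → ℕ) :
    (prefixWord N s).drop k = prefixWord (N - k) (shift k s) := by
  obtain ⟨e, rfl⟩ := Nat.exists_eq_add_of_le h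
  rw [prefixWord_add, List.drop_left' (length_prefixWord k s), Nat.add_sub_cancel_left]

theorem prefixWord_le_iff : prefixWord N s ≤ prefixWord N t ↔ ¬ LtUpTo N t s := by
  rw [← not_lt, not_iff_not, List.lt_iff_exists]
  simp only [length_prefixWord, getElem_prefixWord, lt_irrefl, and_false, false_or]
  exact ⟨fun ⟨d, hd, _, hag, hlt⟩ => ⟨d, hd, hag, hlt⟩,
    fun ⟨d, hd, hag, hlt⟩ => ⟨d, hd, hd, hag, hlt⟩⟩

theorem reflectWord_prefixWord (m N : ℕ) (s : ℕ → ℕ) :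
    reflectWord m (prefixWord N s) = prefixWord N (reflectSeq m s) := by
  simp [reflectWord, prefixWord, reflectSeq, Function.comp_def]

theorem shift_prependWord (w : List ℕ) (s : ℕ → ℕ) : shift w.length (prependWord w s) = s := by
  funext i
  simp [shift, prependWord]

theorem prefixWord_prependWord (w : List ℕ) (s : ℕ → ℕ) :
    prefixWord w.length (prependWord w s) = w :=
  prefixWord_eq_iff.mpr ⟨rfl, fun _ hi => (if_pos hi).symm⟩

theorem eq_prependWord_iff :
    t = prependWord w s ↔ prefixWord w.length t = w ∧ shift w.length t = s := by
  constructor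
  · rintro rfl
    exact ⟨prefixWord_prependWord w s, shift_prependWord w s⟩
  · rintro ⟨hw, rfl⟩
    funext i
    rcases lt_or_ge i w.length with hi | hi
    · rw [prependWord, if_pos hi, (prefixWord_eq_iff.mp hw).2 i hi]
    · rw [prependWord, if_neg hi.not_gt, shift, Nat.add_sub_cancel' hi]

theorem prependWord_prefixWord (N : ℕ) (s : ℕ → ℕ) :
    prependWord (prefixWord N s) (shift N s) = s :=
  (eq_prependWord_iff.mpr (by rw [length_prefixWord]; exact ⟨rfl, rfl⟩)).symm

theorem shift_prependWord_prefixWord (N : ℕ) (s t : ℕ → ℕ) :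
    shift N (prependWord (prefixWord N s) t) = t := by
  simpa only [length_prefixWord] using shift_prependWord (prefixWord N s) t

theorem agree_prependWord_prefixWord (N : ℕ) (s t : ℕ → ℕ) :
    Agree N (prependWord (prefixWord N s) t) s := by
  have := prefixWord_prependWord (prefixWord N s) t
  rwa [length_prefixWord, prefixWord_eq_prefixWord_iff] at this

theorem prependWord_append (u v : List ℕ) (s : ℕ → ℕ) :
    prependWord (u ++ v) s = prependWord u (prependWord v s) := by
  rw [eq_comm, eq_prependWord_iff, List.length_append, prefixWord_add, prefixWord_prependWord,
    ← shift_shift, shift_prependWord, prefixWord_prependWord, shift_prependWord]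
  exact ⟨rfl, rfl⟩

theorem reflectSeq_prependWord (m : ℕ) (w : List ℕ) (s : ℕ → ℕ) :
    reflectSeq m (prependWord w s) = prependWord (reflectWord m w) (reflectSeq m s) := by
  have hlen : (reflectWord m w).length = w.length := List.length_map _
  rw [eq_prependWord_iff, hlen, ← reflectWord_prefixWord, prefixWord_prependWord,
    shift_reflectSeq, shift_prependWord]
  exact ⟨rfl, rfl⟩

theorem prependWord_prefixWord_le (hs : ∀ i, s i ≤ m) (ht : ∀ i, t i ≤ m) (i : ℕ) :
    prependWord (prefixWord N s) t i ≤ m := by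
  rcases lt_or_ge i N with hi | hi
  · rw [agree_prependWord_prefixWord N s t i hi]
    exact hs i
  · rw [prependWord, if_neg (by rw [length_prefixWord]; omega)]
    exact ht _

theorem prependWord_periodicSeq (w : List ℕ) : prependWord w (periodicSeq w) = periodicSeq w := by
  refine (eq_prependWord_iff.mpr ⟨prefixWord_eq_iff.mpr ⟨rfl, fun i hi => ?_⟩, ?_⟩).symm
  · rw [periodicSeq, Nat.mod_eq_of_lt hi]
  · funext i
    simp [shift, periodicSeq]

theorem shift_periodicSeq (w : List ℕ) : shift w.length (periodicSeq w) = periodicSeq w := by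
  conv_lhs => rw [← prependWord_periodicSeq, shift_prependWord]

theorem prefixWord_periodicSeq (w : List ℕ) : prefixWord w.length (periodicSeq w) = w := by
  conv_lhs => rw [← prependWord_periodicSeq, prefixWord_prependWord]

theorem eq_periodicSeq_of_forall {Q : (ℕ → ℕ) → Prop} (hw : w ≠ [])
    (h : ∀ s, Q s → ∃ s', Q s' ∧ s = prependWord w s') (hs : Q s) : s = periodicSeq w := by
  funext i
  induction i using Nat.strong_induction_on generalizing s with
  | _ i ih =>
    obtain ⟨s', hs', rfl⟩ := h s hs
    rw [← prependWord_periodicSeq, prependWord, prependWord]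
    split_ifs with hi
    · rfl
    · exact ih _ (Nat.sub_lt_self (List.length_pos_iff.mpr hw) (not_lt.mp hi)) hs'

theorem eq_periodicSeq (hw : w ≠ []) (h : s = prependWord w s) : s = periodicSeq w :=
  eq_periodicSeq_of_forall (Q := (· = s)) hw (fun _ hs' => ⟨s, rfl, hs'.trans h⟩) rfl

theorem shift_mul_eq (h : shift n s = s) (j : ℕ) : shift (j * n) s = s := by
  induction j with
  | zero => rw [zero_mul, shift_zero]
  | succ j ih => rw [Nat.succ_mul, ← shift_shift, ih, h]

/-! ### The words `c_k` -/

theorem cWord_isPrefix (m : ℕ) (a : List ℕ) (hkl : k ≤ l) : cWord m a k <+: cWord m a l := by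
  induction l, hkl using Nat.le_induction with
  | base => exact List.prefix_rfl
  | succ l _ ih => exact ih.trans (List.prefix_append _ _)

theorem length_plusWord (hw : w ≠ []) : (plusWord w).length = w.length := by
  simp [plusWord, Nat.sub_add_cancel (List.length_pos_iff.mpr hw)]

theorem length_cWord (m : ℕ) (ha : a ≠ []) (k : ℕ) : (cWord m a k).length = a.length * 2 ^ k := by
  induction k with
  | zero => simp [cWord, length_plusWord ha]
  | succ k ih =>
    have hne : reflectWord m (cWord m a k) ≠ [] := by
      rw [← List.length_pos_iff, reflectWord, List.length_map, ih]
      exact Nat.mul_pos (List.length_pos_iff.mpr ha) (Nat.two_pow_pos k)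
    rw [cWord, List.length_append, length_plusWord hne, reflectWord, List.length_map, ih, pow_succ]
    ring

/-- The infinite sequence that starts with each of the words `c_k`. -/
def towerSeq (m : ℕ) (a : List ℕ) : ℕ → ℕ := fun i => (cWord m a i).getD i 0

theorem cWord_eq_prefixWord (m : ℕ) (ha : a ≠ []) (k : ℕ) :
    cWord m a k = prefixWord (a.length * 2 ^ k) (towerSeq m a) := by
  refine (prefixWord_eq_iff.mpr ⟨length_cWord m ha k, fun i hi => ?_⟩).symm
  have hlt : i < (cWord m a i).length := by
    rw [length_cWord m ha]
    exact Nat.lt_two_pow_self.trans_le (Nat.le_mul_of_pos_left _ (List.length_pos_iff.mpr ha))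
  rw [← length_cWord m ha] at hi
  rw [towerSeq, List.getD_eq_getElem _ _ hi, List.getD_eq_getElem _ _ hlt]
  rcases le_total i k with h | h
  · exact ((cWord_isPrefix m a h).getElem hlt).symm
  · exact (cWord_isPrefix m a h).getElem hi

theorem isPlus_of_plusWord_eq (hN : 0 < N) (h : plusWord (prefixWord N s) = prefixWord N t) :
    IsPlus N s t := by
  obtain ⟨k, rfl⟩ := Nat.exists_eq_add_one_of_ne_zero hN.ne'
  rw [prefixWord_succ, prefixWord_succ, plusWord, List.dropLast_concat, List.getLastD_concat,
    List.append_singleton_inj, prefixWord_eq_prefixWord_iff] at h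
  exact ⟨k, rfl, h.1, h.2.symm⟩

theorem isPlus_towerSeq (m : ℕ) (ha : a ≠ []) :
    IsPlus a.length (periodicSeq a) (towerSeq m a) := by
  refine isPlus_of_plusWord_eq (List.length_pos_iff.mpr ha) ?_
  simpa only [cWord, prefixWord_periodicSeq, pow_zero, mul_one] using cWord_eq_prefixWord m ha 0

theorem isPlus_reflectSeq_towerSeq (m : ℕ) (ha : a ≠ []) (k : ℕ) :
    IsPlus (a.length * 2 ^ k) (reflectSeq m (towerSeq m a))
      (shift (a.length * 2 ^ k) (towerSeq m a)) := by
  refine isPlus_of_plusWord_eq (Nat.mul_pos (List.length_pos_iff.mpr ha) (Nat.two_pow_pos k)) ?_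
  have h := cWord_eq_prefixWord m ha (k + 1)
  rwa [cWord, cWord_eq_prefixWord m ha k, pow_succ, ← mul_assoc, mul_two, prefixWord_add,
    List.append_cancel_left_eq, reflectWord_prefixWord] at h

/-- The properties of the shortest period `a` of `α(q₀)` on which the structure of the words `c_k`
depends. -/
structure IsAdmissibleBlock (m : ℕ) (a : List ℕ) : Prop where
  ne_nil : a ≠ []
  minimal : ∀ w : List ℕ, w ≠ [] → periodicSeq w = periodicSeq a → a.length ≤ w.length
  le : ∀ i, periodicSeq a i ≤ m
  last_lt : periodicSeq a (a.length - 1) < m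
  lex_shift_le : ∀ k, toLex (shift k (periodicSeq a)) ≤ toLex (periodicSeq a)
  reflectSeq_lex_shift_le :
    ∀ k, toLex (reflectSeq m (shift k (periodicSeq a))) ≤ toLex (periodicSeq a)

namespace IsAdmissibleBlock

theorem length_pos (h : IsAdmissibleBlock m a) : 0 < a.length := List.length_pos_iff.mpr h.ne_nil

theorem shift_periodicSeq_ltUpTo (h : IsAdmissibleBlock m a) (hi : 0 < i) (hi' : i < a.length) :
    LtUpTo (a.length - i) (shift i (periodicSeq a)) (periodicSeq a) := by
  set A := periodicSeq a with hA
  rcases ltUpTo_trichotomy (a.length - i) (shift i A) A with h' | h' | h'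
  · exact h'
  · have hper : shift (a.length - i) (shift i A) = A := by
      rw [shift_shift, Nat.add_sub_cancel' hi'.le, hA, shift_periodicSeq]
    have hle := lex_le_shift h' (h.lex_shift_le i)
    rw [hper] at hle
    have heq : shift (a.length - i) A = A := toLex.injective ((h.lex_shift_le _).antisymm hle)
    have hne : prefixWord (a.length - i) A ≠ [] := by
      rw [← List.length_pos_iff, length_prefixWord]
      omega
    have hA' : A = periodicSeq (prefixWord (a.length - i) A) := eq_periodicSeq hne <| by
      conv_lhs => rw [← prependWord_prefixWord (a.length - i) A, heq]
    have := h.minimal _ hne hA'.symm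
    rw [length_prefixWord] at this
    omega
  · exact absurd h' (not_ltUpTo_of_lex_le (h.lex_shift_le i))

theorem towerSeq_le (h : IsAdmissibleBlock m a) : ∀ i < a.length, towerSeq m a i ≤ m := by
  obtain ⟨k, hk, hag, hlast⟩ := isPlus_towerSeq m h.ne_nil
  intro i hi
  rcases Nat.lt_succ_iff_lt_or_eq.mp (hk ▸ hi) with hik | rfl
  · exact hag i hik ▸ h.le i
  · have := h.last_lt
    rw [← hk, Nat.add_sub_cancel] at this
    omega

theorem admissible (h : IsAdmissibleBlock m a) : Admissible m a.length (towerSeq m a) := by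
  intro i hi
  have hplus := isPlus_towerSeq m h.ne_nil
  have hshift : IsPlus (a.length - i) (shift i (periodicSeq a)) (shift i (towerSeq m a)) :=
    IsPlus.shift (by rwa [Nat.add_sub_cancel' hi.le]) (by omega)
  have hle : ∀ j < a.length - i, shift i (towerSeq m a) j ≤ m := fun j hj =>
    h.towerSeq_le _ (by omega)
  have hag : 0 < i → Agree (a.length - i) (periodicSeq a) (towerSeq m a) := fun hi0 => by
    obtain ⟨k, hk, hag, -⟩ := hplus
    exact hag.mono (by omega)
  constructor
  · rcases Nat.eq_zero_or_pos i with rfl | hi0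
    · rw [shift_zero]
      exact fun h' => h'.asymm h'
    · rw [hshift.ltUpTo_iff, not_not]
      exact (h.shift_periodicSeq_ltUpTo hi0 hi).congr (fun _ _ => rfl) (hag hi0)
  · by_contra hlt
    have hlt' := (hshift.reflectSeq hle).ltUpTo_iff.mpr hlt
    refine not_ltUpTo_of_lex_le (h.reflectSeq_lex_shift_le i) (n := a.length - i) ?_
    rcases Nat.eq_zero_or_pos i with rfl | hi0
    · exact hplus.ltUpTo.trans hlt'
    · exact hlt'.congr (hag hi0).symm fun _ _ => rfl

protected theorem isTower (h : IsAdmissibleBlock m a) : IsTower m a.length (towerSeq m a) where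
  pos := h.length_pos
  le₀ := h.towerSeq_le
  admissible₀ := h.admissible
  isPlus := isPlus_reflectSeq_towerSeq m h.ne_nil

end IsAdmissibleBlock

end

/-! ### Products of blocks -/

namespace ExtWord

theorem append_assoc (x y z : ExtWord) : (x.append y).append z = x.append (y.append z) := by
  cases x <;> cases y <;> cases z <;> simp [append, prependWord_append]

theorem nil_append (x : ExtWord) : (fin []).append x = x := by
  cases x <;> rfl

theorem append_nil (x : ExtWord) : x.append (fin []) = x := by
  cases x <;> simp [append]

theorem fin_append_eq_inf {u : List ℕ} {x : ExtWord} {t : ℕ → ℕ} (h : (fin u).append x = inf t) :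
    ∃ t', x = inf t' ∧ t = prependWord u t' := by
  cases x with
  | fin v => nomatch h
  | inf t' => exact ⟨t', rfl, (inf.inj h).symm⟩

end ExtWord

theorem wordPow_zero (w : List ℕ) : wordPow w 0 = .fin [] := rfl

theorem wordPow_top (w : List ℕ) : wordPow w ⊤ = .inf (periodicSeq w) := rfl

theorem wordPow_add_one (w : List ℕ) (j : ℕ∞) :
    wordPow w (j + 1) = (ExtWord.fin w).append (wordPow w j) := by
  induction j with
  | top => rw [top_add, wordPow_top, ExtWord.append, prependWord_periodicSeq]
  | coe j =>
    change ExtWord.fin (List.replicate (j + 1) w).flatten = _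
    rw [List.replicate_succ, List.flatten_cons]
    rfl

theorem wordPow_one (w : List ℕ) : wordPow w 1 = .fin w := by
  rw [← zero_add (1 : ℕ∞), wordPow_add_one, wordPow_zero, ExtWord.append_nil]

/-- The word `c_k` followed by the reflection of `c_k'`. -/
def pairWord (m : ℕ) (a : List ℕ) (k k' : ℕ) : List ℕ :=
  cWord m a k ++ reflectWord m (cWord m a k')

/-- The infinite products `(c_{i₀} c̄_{i₀})^{j₀} (c_{i₀} c̄_{i₁})^{l₀} ⋯ (c_{i_r} c̄_{i_r})^{j_r}`
with `k = i₀ < ⋯ < i_r < ℓ` and exponents `l_s ≤ 1`, generated from the right. -/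
inductive BlockTail (m : ℕ) (a : List ℕ) (ℓ : ℕ) : ℕ → (ℕ → ℕ) → Prop
  | periodic {k : ℕ} (hk : k < ℓ) : BlockTail m a ℓ k (periodicSeq (pairWord m a k k))
  | same {k : ℕ} {t : ℕ → ℕ} (h : BlockTail m a ℓ k t) :
      BlockTail m a ℓ k (prependWord (pairWord m a k k) t)
  | skip {k k' : ℕ} {t : ℕ → ℕ} (hk : k < k') (h : BlockTail m a ℓ k' t) : BlockTail m a ℓ k t
  | step {k k' : ℕ} {t : ℕ → ℕ} (hk : k < k') (h : BlockTail m a ℓ k' t) :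
      BlockTail m a ℓ k (prependWord (pairWord m a k k') t)

section

variable {m ℓ k k' : ℕ} {a : List ℕ} {t g : ℕ → ℕ} {x : ExtWord}

theorem blockProduct_succ (m : ℕ) (a : List ℕ) (i : ℕ → ℕ) (j : ℕ → ℕ∞) (l : ℕ → ℕ) (r : ℕ) :
    blockProduct m a i j l (r + 1) =
      (wordPow (pairWord m a (i 0) (i 0)) (j 0)).append
        ((wordPow (pairWord m a (i 0) (i 1)) (l 0)).append
          (blockProduct m a (fun s => i (s + 1)) (fun s => j (s + 1)) (fun s => l (s + 1)) r)) := by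
  induction r with
  | zero => simp only [blockProduct, ExtWord.append_assoc]; rfl
  | succ r ih =>
    rw [blockProduct, ih, blockProduct]
    simp only [ExtWord.append_assoc]

theorem blockProduct_update_zero (m : ℕ) (a : List ℕ) (i : ℕ → ℕ) (j : ℕ → ℕ∞) (l : ℕ → ℕ)
    (r : ℕ) :
    blockProduct m a i (Function.update j 0 (j 0 + 1)) l r =
      (ExtWord.fin (pairWord m a (i 0) (i 0))).append (blockProduct m a i j l r) := by
  cases r with
  | zero => simp only [blockProduct, Function.update_self, wordPow_add_one, pairWord]
  | succ r =>
    simp only [blockProduct_succ, Function.update_self, wordPow_add_one, ExtWord.append_assoc,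
      Function.update_of_ne (Nat.succ_ne_zero _)]

/-- `x` is one of the products in `HasBlockForm`, with first index `i₀ = k`. -/
def IsBlockProduct (m : ℕ) (a : List ℕ) (ℓ k : ℕ) (x : ExtWord) : Prop :=
  ∃ (r : ℕ) (i : ℕ → ℕ) (j : ℕ → ℕ∞) (l : ℕ → ℕ), i 0 = k ∧ (∀ s < r, i s < i (s + 1)) ∧
    i r < ℓ ∧ (∀ s < r, l s ≤ 1) ∧ blockProduct m a i j l r = x

theorem IsBlockProduct.cons (h : IsBlockProduct m a ℓ k' x) (hk : k < k') {e : ℕ} (he : e ≤ 1) :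
    IsBlockProduct m a ℓ k ((wordPow (pairWord m a k k') e).append x) := by
  obtain ⟨r, i, j, l, rfl, hi, hr, hl, rfl⟩ := h
  refine ⟨r + 1, fun | 0 => k | s + 1 => i s, fun | 0 => 0 | s + 1 => j s,
    fun | 0 => e | s + 1 => l s, rfl, ?_, hr, ?_, ?_⟩
  · rintro (_ | s) hs
    exacts [hk, hi s (by omega)]
  · rintro (_ | s) hs
    exacts [he, hl s (by omega)]
  · rw [blockProduct_succ, wordPow_zero, ExtWord.nil_append]

theorem BlockTail.isBlockProduct (h : BlockTail m a ℓ k t) :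
    IsBlockProduct m a ℓ k (.inf t) := by
  induction h with
  | @periodic k hk =>
    exact ⟨0, fun _ => k, fun _ => ⊤, fun _ => 0, rfl, by simp, hk, by simp, rfl⟩
  | same _ ih =>
    obtain ⟨r, i, j, l, rfl, hi, hr, hl, hx⟩ := ih
    exact ⟨r, i, _, l, rfl, hi, hr, hl, by rw [blockProduct_update_zero, hx, ExtWord.append]⟩
  | skip hk _ ih =>
    have h := ih.cons hk zero_le_one
    rwa [Nat.cast_zero, wordPow_zero, ExtWord.nil_append] at h
  | step hk _ ih =>
    have h := ih.cons hk le_rfl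
    rwa [Nat.cast_one, wordPow_one] at h

theorem BlockTail.of_wordPow_append {j : ℕ∞} (hk : k < ℓ)
    (hx : ∀ t, x = .inf t → BlockTail m a ℓ k t)
    (ht : (wordPow (pairWord m a k k) j).append x = .inf t) : BlockTail m a ℓ k t := by
  induction j with
  | top =>
    obtain rfl : periodicSeq (pairWord m a k k) = t := ExtWord.inf.inj ht
    exact .periodic hk
  | coe j =>
    induction j generalizing t with
    | zero =>
      rw [Nat.cast_zero, wordPow_zero, ExtWord.nil_append] at ht
      exact hx t ht
    | succ j ih =>
      rw [Nat.cast_succ, wordPow_add_one, ExtWord.append_assoc] at ht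
      obtain ⟨t', ht', rfl⟩ := ExtWord.fin_append_eq_inf ht
      exact (ih ht').same

theorem IsBlockProduct.blockTail (h : IsBlockProduct m a ℓ k (.inf t)) : BlockTail m a ℓ k t := by
  obtain ⟨r, i, j, l, rfl, hi, hr, hl, ht⟩ := h
  suffices i 0 < ℓ ∧ ∀ t, blockProduct m a i j l r = .inf t → BlockTail m a ℓ (i 0) t from
    this.2 t ht
  clear ht
  induction r generalizing i j l with
  | zero =>
    refine ⟨hr, fun t ht => .of_wordPow_append (j := j 0) (x := .fin []) hr
      (fun _ h => nomatch h) ?_⟩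
    rwa [ExtWord.append_nil]
  | succ r ih =>
    have ⟨h1, htail⟩ := ih (i := fun s => i (s + 1)) (j := fun s => j (s + 1))
      (l := fun s => l (s + 1)) (fun s hs => hi _ (by omega)) hr fun s hs => hl _ (by omega)
    have h01 : i 0 < i 1 := hi 0 r.succ_pos
    refine ⟨h01.trans h1, fun t ht => .of_wordPow_append (h01.trans h1) (fun t' ht' => ?_)
      ((blockProduct_succ ..).symm.trans ht)⟩
    rcases Nat.le_one_iff_eq_zero_or_eq_one.mp (hl 0 r.succ_pos) with h0 | h0
    · rw [h0, Nat.cast_zero, wordPow_zero, ExtWord.nil_append] at ht'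
      exact .skip h01 (htail t' ht')
    · rw [h0, Nat.cast_one, wordPow_one] at ht'
      obtain ⟨s, hs, rfl⟩ := ExtWord.fin_append_eq_inf ht'
      exact .step h01 (htail s hs)

theorem IsTower.ne_nil {C : ℕ → ℕ} (h : IsTower m a.length C) : a ≠ [] :=
  List.length_pos_iff.mp h.pos

theorem prependWord_pairWord (m : ℕ) (ha : a ≠ []) (k k' : ℕ) (t : ℕ → ℕ) :
    prependWord (pairWord m a k k') t =
      prependWord (prefixWord (a.length * 2 ^ k) (towerSeq m a))
        (prependWord (prefixWord (a.length * 2 ^ k') (reflectSeq m (towerSeq m a))) t) := by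
  rw [pairWord, prependWord_append, cWord_eq_prefixWord m ha, cWord_eq_prefixWord m ha,
    reflectWord_prefixWord]

theorem prependWord_pairWord_le (hT : IsTower m a.length (towerSeq m a))
    (ht : ∀ i, t i ≤ m) : ∀ i, prependWord (pairWord m a k k') t i ≤ m := by
  rw [prependWord_pairWord m hT.ne_nil]
  exact prependWord_prefixWord_le hT.le (prependWord_prefixWord_le (reflectSeq_le m _) ht)

theorem agree_prependWord_pairWord (ha : a ≠ []) :
    Agree (a.length * 2 ^ k) (prependWord (pairWord m a k k') t) (towerSeq m a) := by
  rw [prependWord_pairWord m ha]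
  exact agree_prependWord_prefixWord _ _ _

theorem agree_periodicSeq_pairWord (m : ℕ) (ha : a ≠ []) (k k' : ℕ) :
    Agree (a.length * 2 ^ k) (periodicSeq (pairWord m a k k')) (towerSeq m a) := by
  rw [← prependWord_periodicSeq]
  exact agree_prependWord_pairWord ha

theorem reflectSeq_shift_prependWord_pairWord (hT : IsTower m a.length (towerSeq m a))
    (k k' : ℕ) (t : ℕ → ℕ) :
    reflectSeq m (shift (a.length * 2 ^ k) (prependWord (pairWord m a k k') t)) =
      prependWord (prefixWord (a.length * 2 ^ k') (towerSeq m a)) (reflectSeq m t) := by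
  rw [prependWord_pairWord m hT.ne_nil, shift_prependWord_prefixWord, reflectSeq_prependWord,
    reflectWord_prefixWord, reflectSeq_reflectSeq hT.le]

theorem pairWord_ne_nil (m : ℕ) (ha : a ≠ []) (k k' : ℕ) : pairWord m a k k' ≠ [] := by
  have hk : 0 < (cWord m a k).length := by
    rw [length_cWord m ha]
    exact Nat.mul_pos (List.length_pos_iff.mpr ha) (Nat.two_pow_pos k)
  exact List.append_ne_nil_of_left_ne_nil (List.length_pos_iff.mp hk) _

theorem reflectSeq_shift_periodicSeq_pairWord (hT : IsTower m a.length (towerSeq m a)) (k : ℕ) :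
    reflectSeq m (shift (a.length * 2 ^ k) (periodicSeq (pairWord m a k k))) =
      periodicSeq (pairWord m a k k) := by
  set p := periodicSeq (pairWord m a k k)
  have hcons : p = prependWord (pairWord m a k k) p := (prependWord_periodicSeq _).symm
  have hagree : Agree (a.length * 2 ^ k) (reflectSeq m p) (reflectSeq m (towerSeq m a)) :=
    (agree_periodicSeq_pairWord m hT.ne_nil k k).reflectSeq
  have hshift : reflectSeq m (shift (a.length * 2 ^ k) p) =
      prependWord (prefixWord (a.length * 2 ^ k) (towerSeq m a)) (reflectSeq m p) := by
    conv_lhs => rw [hcons, reflectSeq_shift_prependWord_pairWord hT]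
  refine eq_periodicSeq (pairWord_ne_nil m hT.ne_nil k k) ?_
  rw [prependWord_pairWord m hT.ne_nil, ← prefixWord_eq_prefixWord_iff.mpr hagree,
    ← shift_reflectSeq, prependWord_prefixWord, shift_reflectSeq, hshift]

theorem IsTower.tailsLtUpTo_prependWord {n : ℕ} {C : ℕ → ℕ} (h : IsTower m n C) (hkl : k < ℓ)
    (ht : ∀ i, t i ≤ m) (hag : Agree (n * 2 ^ k) t C) (htail : TailsLtUpTo m (n * 2 ^ ℓ) C t) :
    TailsLtUpTo m (n * 2 ^ ℓ) C (prependWord (prefixWord (n * 2 ^ k) C) (reflectSeq m t)) := by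
  have hshift : reflectSeq m (shift (n * 2 ^ k)
      (prependWord (prefixWord (n * 2 ^ k) C) (reflectSeq m t))) = t := by
    rw [shift_prependWord_prefixWord, reflectSeq_reflectSeq ht]
  exact h.tailsLtUpTo_of_reflectSeq_shift hkl
    ⟨agree_prependWord_prefixWord _ _ _, by rwa [hshift]⟩
    (prependWord_prefixWord_le h.le (reflectSeq_le m t)) (by rwa [hshift])

theorem prependWord_pairWord_eq_reflectSeq (ha : a ≠ []) (ht : ∀ i, t i ≤ m) (k k' : ℕ) :
    prependWord (pairWord m a k k') t =
      prependWord (prefixWord (a.length * 2 ^ k) (towerSeq m a)) (reflectSeq m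
        (prependWord (prefixWord (a.length * 2 ^ k') (towerSeq m a)) (reflectSeq m t))) := by
  rw [prependWord_pairWord m ha, reflectSeq_prependWord, reflectWord_prefixWord,
    reflectSeq_reflectSeq ht]

namespace BlockTail

theorem lt (h : BlockTail m a ℓ k t) : k < ℓ := by
  induction h with
  | periodic hk => exact hk
  | same _ ih => exact ih
  | skip hk _ ih | step hk _ ih => exact hk.trans ih

theorem agree (h : BlockTail m a ℓ k t) (ha : a ≠ []) :
    Agree (a.length * 2 ^ k) t (towerSeq m a) := by
  induction h with
  | periodic _ => exact agree_periodicSeq_pairWord m ha _ _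
  | same _ _ | step _ _ _ => exact agree_prependWord_pairWord ha
  | skip hk _ ih => exact ih.mono (IsTower.length_mono _ hk.le)

theorem le (h : BlockTail m a ℓ k t) (hT : IsTower m a.length (towerSeq m a)) :
    ∀ i, t i ≤ m := by
  induction h with
  | periodic _ => exact le_of_reflectSeq_eq (reflectSeq_shift_periodicSeq_pairWord hT _)
  | same _ ih | step _ _ ih => exact prependWord_pairWord_le hT ih
  | skip _ _ ih => exact ih

theorem tailsLtUpTo (h : BlockTail m a ℓ k t) (hT : IsTower m a.length (towerSeq m a)) :
    TailsLtUpTo m (a.length * 2 ^ ℓ) (towerSeq m a) t := by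
  have hpair : ∀ {k k' : ℕ} {t : ℕ → ℕ}, k ≤ k' → BlockTail m a ℓ k' t →
      TailsLtUpTo m (a.length * 2 ^ ℓ) (towerSeq m a) t →
      TailsLtUpTo m (a.length * 2 ^ ℓ) (towerSeq m a) (prependWord (pairWord m a k k') t) := by
    intro k k' t hk h ih
    rw [prependWord_pairWord_eq_reflectSeq hT.ne_nil (h.le hT)]
    exact hT.tailsLtUpTo_prependWord (hk.trans_lt h.lt)
      (prependWord_prefixWord_le hT.le (reflectSeq_le m t))
      ((agree_prependWord_prefixWord _ _ _).mono (IsTower.length_mono _ hk))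
      (hT.tailsLtUpTo_prependWord h.lt (h.le hT) (h.agree hT.ne_nil) ih)
  induction h with
  | periodic hk =>
    exact hT.tailsLtUpTo_of_reflectSeq_shift_eq hk ((BlockTail.periodic hk).agree hT.ne_nil)
      (reflectSeq_shift_periodicSeq_pairWord hT _)
  | same h ih => exact hpair le_rfl h ih
  | skip _ _ ih => exact ih
  | step hk h ih => exact hpair hk.le h ih

end BlockTail

theorem exists_eq_prependWord_pairWord (hT : IsTower m a.length (towerSeq m a))
    (hkl : k < ℓ) (hg : Agree (a.length * 2 ^ ℓ) g (towerSeq m a))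
    (hg' : reflectSeq m (shift (a.length * 2 ^ ℓ) g) = g)
    (htm : ∀ i, t i ≤ m) (hlt : TailsLt m g t) (ht : Agree (a.length * 2 ^ k) t (towerSeq m a)) :
    ∃ k₁ k₂ t', k ≤ k₁ ∧ k₁ ≤ k₂ ∧ k₂ < ℓ ∧ (∀ i, t' i ≤ m) ∧ TailsLt m g t' ∧
      Agree (a.length * 2 ^ k₂) t' (towerSeq m a) ∧ t = prependWord (pairWord m a k₁ k₂) t' := by
  obtain ⟨k₁, hk₁, hk₁', hag, hag'⟩ := hT.exists_startsWithPair hkl hg hg' hlt ht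
  set s := reflectSeq m (shift (a.length * 2 ^ k₁) t) with hs
  have hslt : TailsLt m g s := (hlt.shift _).reflectSeq fun _ => htm _
  obtain ⟨k₂, hk₂, hk₂', hag₂, hag₂'⟩ := hT.exists_startsWithPair hk₁' hg hg' hslt hag'
  have hsm : ∀ i, s i ≤ m := reflectSeq_le m _
  refine ⟨k₁, k₂, reflectSeq m (shift (a.length * 2 ^ k₂) s), hk₁, hk₂, hk₂', reflectSeq_le m _,
    (hslt.shift _).reflectSeq fun _ => hsm _, hag₂', ?_⟩
  rw [prependWord_pairWord_eq_reflectSeq hT.ne_nil (reflectSeq_le m _),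
    reflectSeq_reflectSeq_shift hsm, ← prefixWord_eq_prefixWord_iff.mpr hag₂,
    prependWord_prefixWord, hs, reflectSeq_reflectSeq_shift htm,
    ← prefixWord_eq_prefixWord_iff.mpr hag, prependWord_prefixWord]

theorem blockTail_of_tailsLt (hT : IsTower m a.length (towerSeq m a))
    (hkl : k < ℓ) (hg : Agree (a.length * 2 ^ ℓ) g (towerSeq m a))
    (hg' : reflectSeq m (shift (a.length * 2 ^ ℓ) g) = g)
    (htm : ∀ i, t i ≤ m) (hlt : TailsLt m g t) (ht : Agree (a.length * 2 ^ k) t (towerSeq m a)) :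
    BlockTail m a ℓ k t := by
  induction hd : ℓ - k using Nat.strong_induction_on generalizing k t with
  | _ d ih =>
    by_contra hnot
    -- Otherwise only blocks `c_k c̄_k` could ever be split off.
    have hper : t = periodicSeq (pairWord m a k k) := by
      refine eq_periodicSeq_of_forall (Q := fun t => (∀ i, t i ≤ m) ∧ TailsLt m g t ∧
        Agree (a.length * 2 ^ k) t (towerSeq m a) ∧ ¬ BlockTail m a ℓ k t)
        (pairWord_ne_nil m hT.ne_nil k k) ?_ ⟨htm, hlt, ht, hnot⟩
      rintro t ⟨htm, hlt, ht, hnot⟩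
      obtain ⟨k₁, k₂, t', hk₁, hk₂, hk₂', htm', hlt', ht', rfl⟩ :=
        exists_eq_prependWord_pairWord hT hkl hg hg' htm hlt ht
      rcases (hk₁.trans hk₂).eq_or_lt with rfl | hkk₂
      · obtain rfl : k = k₁ := hk₁.antisymm hk₂
        exact ⟨t', ⟨htm', hlt', ht', fun h => hnot h.same⟩, rfl⟩
      have htail : BlockTail m a ℓ k₂ t' := ih _ (by omega) hk₂' htm' hlt' ht' rfl
      refine absurd ?_ hnot
      rcases hk₂.eq_or_lt with rfl | hk₁₂
      · exact .skip hkk₂ htail.same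
      · rcases hk₁.eq_or_lt with rfl | hkk₁
        · exact .step hk₁₂ htail
        · exact .skip hkk₁ (.step hk₁₂ htail)
    exact hnot (hper ▸ .periodic hkl)

end

/-! ### Matched words -/

section

variable {m ℓ p P : ℕ} {a ω : List ℕ} {b g s t A : ℕ → ℕ}

theorem TailsLtUpTo.tailsLt {N : ℕ} {C : ℕ → ℕ} (h : TailsLtUpTo m N C t) (hg : Agree N g C) :
    TailsLt m g t := fun K =>
  ⟨((h K).1.congr (fun _ _ => rfl) hg.symm).lex_lt,
    ((h K).2.congr (fun _ _ => rfl) hg.symm).lex_lt⟩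

theorem prefixWord_ne_replicate_iff {N x : ℕ} :
    prefixWord N s ≠ List.replicate N x ↔ ∃ i < N, s i ≠ x := by
  have : List.replicate N x = prefixWord N fun _ => x := by simp [prefixWord]
  rw [this, ne_eq, prefixWord_eq_prefixWord_iff]
  simp [Agree]

theorem take_drop_prefixWord_append (hs : shift P s = periodicSeq a) {k : ℕ} (hk : k ≤ P) :
    ((prefixWord P s ++ a).drop k).take a.length = prefixWord a.length (shift k s) := by
  have : prefixWord P s ++ a = prefixWord (P + a.length) s := by
    rw [prefixWord_add, hs, prefixWord_periodicSeq]
  rw [this, drop_prefixWord (by omega), take_prefixWord (by omega)]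

theorem isMatched_prefixWord_iff (hs : shift (p + 1) s = periodicSeq a) (hsm : ∀ i, s i ≤ m) :
    IsMatched m a (prefixWord (p + 1) s) ↔ s p < m ∧ ∀ k, 1 ≤ k → k ≤ p + 1 →
      ((∃ i < k, s i < m) → ¬ LtUpTo a.length (periodicSeq a) (shift k s)) ∧
      ((∃ i < k, 0 < s i) → ¬ LtUpTo a.length (periodicSeq a) (reflectSeq m (shift k s))) := by
  have hA : ∀ i, periodicSeq a i ≤ m := hs ▸ fun _ => hsm _
  have hne : prefixWord (p + 1) s ≠ [] := by simp [prefixWord_succ]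
  have hle : ∀ d ∈ prefixWord (p + 1) s, d ≤ m := by
    simpa [prefixWord] using fun i _ => hsm i
  rw [IsMatched, and_iff_right hne, and_iff_right hle, length_prefixWord]
  refine and_congr (by rw [prefixWord_succ, List.getLastD_concat]) ?_
  refine forall_congr' fun k => imp_congr_right fun _ => imp_congr_right fun hk => ?_
  have hrefl : LtUpTo a.length (shift k s) (reflectSeq m (periodicSeq a)) ↔
      LtUpTo a.length (periodicSeq a) (reflectSeq m (shift k s)) := by
    constructor <;> intro h
    · simpa only [reflectSeq_reflectSeq hA] using h.reflectSeq (reflectSeq_le m _)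
    · simpa only [reflectSeq_reflectSeq_shift hsm] using h.reflectSeq (reflectSeq_le m _)
  have hreflectWord : reflectWord m a = prefixWord a.length (reflectSeq m (periodicSeq a)) := by
    rw [← reflectWord_prefixWord, prefixWord_periodicSeq]
  rw [take_prefixWord hk, take_drop_prefixWord_append hs hk, hreflectWord,
    prefixWord_ne_replicate_iff, prefixWord_ne_replicate_iff, prefixWord_le_iff, hrefl]
  nth_rw 2 [← prefixWord_periodicSeq a]
  simp only [prefixWord_le_iff, pos_iff_ne_zero, (hsm _).lt_iff_ne]

theorem IsMatched.prependWord_le (hω : IsMatched m a ω) (ht : ∀ i, t i ≤ m) (i : ℕ) :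
    prependWord ω t i ≤ m := by
  rw [prependWord]
  split_ifs with hi
  · rw [List.getD_eq_getElem _ _ hi]
    exact hω.2.1 _ (List.getElem_mem hi)
  · exact ht _

theorem IsMatched.exists_eq_prefixWord (hω : IsMatched m a ω) (ha : ∀ i, periodicSeq a i ≤ m) :
    ∃ p s, ω = prefixWord (p + 1) s ∧ shift (p + 1) s = periodicSeq a ∧ ∀ i, s i ≤ m := by
  obtain ⟨p, hp⟩ := Nat.exists_eq_add_one_of_ne_zero (List.length_pos_iff.mpr hω.1).ne'
  exact ⟨p, prependWord ω (periodicSeq a), hp ▸ (prefixWord_prependWord ω _).symm,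
    hp ▸ shift_prependWord ω _, hω.prependWord_le ha⟩

theorem IsMatched.exists_shift_eq (hω : IsMatched m a ω) (ha : ∀ i, periodicSeq a i ≤ m)
    (t : ℕ → ℕ) : ∃ i, prependWord ω t i < m ∧ shift (i + 1) (prependWord ω t) = t := by
  obtain ⟨p, s, rfl, hs, hsm⟩ := hω.exists_eq_prefixWord ha
  refine ⟨p, ?_, shift_prependWord_prefixWord _ _ _⟩
  rw [agree_prependWord_prefixWord _ s t p p.lt_succ_self]
  exact ((isMatched_prefixWord_iff hs hsm).mp hω).1

theorem IsMatched.lexBounded (hω : IsMatched m a ω) (ha : a ≠ []) (hA : ∀ i, periodicSeq a i ≤ m)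
    (htm : ∀ i, t i ≤ m) (ht : Agree (a.length - 1) t (periodicSeq a))
    (hg : Agree a.length g (towerSeq m a)) (htail : TailsLt m g t) :
    LexBounded m g (prependWord ω t) := by
  refine ⟨hω.prependWord_le htm, fun i => ?_⟩
  obtain ⟨p, s, rfl, hs, hsm⟩ := hω.exists_eq_prefixWord hA
  set b := prependWord (prefixWord (p + 1) s) t
  have hbt : shift (p + 1) b = t := shift_prependWord_prefixWord _ _ _
  have hbs : Agree (p + 1 + (a.length - 1)) b s :=
    agree_add_iff.mpr ⟨agree_prependWord_prefixWord _ _ _, by rwa [hbt, hs]⟩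
  rcases le_or_gt p i with hi | hi
  · obtain ⟨K, hK⟩ := Nat.exists_eq_add_of_le (Nat.add_le_add_right hi 1)
    rw [hK, ← shift_shift, hbt]
    exact ⟨fun _ => (htail K).1, fun _ => (htail K).2⟩
  · have hlt : ∀ {x}, ¬ LtUpTo a.length (periodicSeq a) x → LtUpTo a.length x g := fun h =>
      ((isPlus_towerSeq m ha).ltUpTo_iff.mpr h).congr (fun _ _ => rfl) hg.symm
    have hagree : Agree a.length (shift (i + 1) s) (shift (i + 1) b) :=
      Agree.shift (hbs.mono (by omega)).symm
    have hwindow := ((isMatched_prefixWord_iff hs hsm).mp hω).2 (i + 1) (by omega) (by omega)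
    rw [hbs i (by omega)]
    exact ⟨fun h => ((hlt (hwindow.1 ⟨i, by omega, h⟩)).congr hagree fun _ _ => rfl).lex_lt,
      fun h => ((hlt (hwindow.2 ⟨i, by omega, h⟩)).congr hagree.reflectSeq fun _ _ => rfl).lex_lt⟩

theorem IsAdmissibleBlock.tailsLtUpTo_periodicSeq (ha : IsAdmissibleBlock m a) :
    TailsLtUpTo m a.length (towerSeq m a) (periodicSeq a) := fun K =>
  have hplus := isPlus_towerSeq m ha.ne_nil
  ⟨hplus.ltUpTo_iff.mpr (not_ltUpTo_of_lex_le (ha.lex_shift_le K)),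
    hplus.ltUpTo_iff.mpr (not_ltUpTo_of_lex_le (ha.reflectSeq_lex_shift_le K))⟩

theorem HasBlockForm.exists_tail (hb : HasBlockForm m a ℓ b) (ha : IsAdmissibleBlock m a) :
    ∃ ω t, IsMatched m a ω ∧ b = prependWord ω t ∧ (∀ i, t i ≤ m) ∧
      Agree (a.length - 1) t (periodicSeq a) ∧ toLex (periodicSeq a) ≤ toLex t ∧
      TailsLtUpTo m (a.length * 2 ^ ℓ) (towerSeq m a) t := by
  obtain ⟨ω, e, r, i, j, l, hω, rfl | rfl, hi, hir, hl, h⟩ := hb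
  · rw [wordPow_zero, ExtWord.append_assoc, ExtWord.nil_append] at h
    obtain ⟨t, ht, rfl⟩ := ExtWord.fin_append_eq_inf h
    have htail : BlockTail m a ℓ (i 0) t :=
      IsBlockProduct.blockTail ⟨r, i, j, l, rfl, hi, hir, hl, ht⟩
    have htC : Agree a.length t (towerSeq m a) := (htail.agree ha.ne_nil).mono (by
      simpa using IsTower.length_mono a.length (Nat.zero_le (i 0)))
    have hplus := (isPlus_towerSeq m ha.ne_nil).congr (fun _ _ => rfl) htC.symm
    exact ⟨ω, t, hω, rfl, htail.le ha.isTower, hplus.agree.symm, hplus.ltUpTo.lex_lt.le,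
      htail.tailsLtUpTo ha.isTower⟩
  · refine ⟨ω, periodicSeq a, hω, (ExtWord.inf.inj h).symm, ha.le, fun _ _ => rfl, le_rfl,
      fun K => ?_⟩
    have hlen : a.length ≤ a.length * 2 ^ ℓ := Nat.le_mul_of_pos_right _ (Nat.two_pow_pos ℓ)
    exact ⟨(ha.tailsLtUpTo_periodicSeq K).1.mono hlen, (ha.tailsLtUpTo_periodicSeq K).2.mono hlen⟩

theorem HasBlockForm.lexBounded (hb : HasBlockForm m a ℓ b) (ha : IsAdmissibleBlock m a)
    (hg : Agree (a.length * 2 ^ ℓ) g (towerSeq m a)) : LexBounded m g b := by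
  obtain ⟨ω, t, hω, rfl, htm, htA, -, htail⟩ := hb.exists_tail ha
  exact hω.lexBounded ha.ne_nil ha.le htm htA
    (hg.mono (Nat.le_mul_of_pos_right _ (Nat.two_pow_pos ℓ))) (htail.tailsLt hg)

theorem HasBlockForm.not_lexBounded_periodicSeq (hb : HasBlockForm m a ℓ b)
    (ha : IsAdmissibleBlock m a) : ¬ LexBounded m (periodicSeq a) b := by
  obtain ⟨ω, t, hω, rfl, -, -, hAt, -⟩ := hb.exists_tail ha
  obtain ⟨i, hi, hit⟩ := hω.exists_shift_eq ha.le t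
  intro h
  have := (h.2 i).1 hi
  rw [hit] at this
  exact this.not_ge hAt

theorem isMatched_prefixWord (ha : IsAdmissibleBlock m a) (hbm : ∀ i, b i ≤ m)
    (hmin : ∀ i < p, (b i < m → toLex (shift (i + 1) b) < toLex (periodicSeq a)) ∧
      (0 < b i → toLex (reflectSeq m (shift (i + 1) b)) < toLex (periodicSeq a)))
    (hag : Agree (a.length - 1) (shift (p + 1) b) (periodicSeq a)) {J : ℕ}
    (hJ : Agree (J * a.length) (shift (p + 1) b) (periodicSeq a))
    (hlast : b (p + J * a.length) < m) :
    IsMatched m a (prefixWord (p + J * a.length + 1) b) := by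
  set s := prependWord (prefixWord (p + 1) b) (periodicSeq a)
  have hsA : shift (p + 1) s = periodicSeq a := shift_prependWord_prefixWord _ _ _
  have hsb : Agree (p + 1) s b := agree_prependWord_prefixWord _ _ _
  have hsb' : Agree (p + 1 + (a.length - 1)) s b :=
    agree_add_iff.mpr ⟨hsb, by rw [hsA]; exact hag.symm⟩
  have hsm : ∀ i, s i ≤ m := prependWord_prefixWord_le hbm ha.le
  have hper : shift (p + J * a.length + 1) s = periodicSeq a := by
    rw [add_right_comm, ← shift_shift, hsA, shift_mul_eq (shift_periodicSeq a)]
  have hsbP : Agree (p + J * a.length + 1) s b := by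
    rw [add_right_comm]
    exact agree_add_iff.mpr ⟨hsb, by rw [hsA]; exact hJ.symm⟩
  rw [← prefixWord_eq_prefixWord_iff.mpr hsbP, isMatched_prefixWord_iff hper hsm,
    hsbP _ (Nat.lt_succ_self _)]
  refine ⟨hlast, fun k hk hkP => ?_⟩
  rcases le_or_gt k p with hkp | hkp
  · have hagree : Agree a.length (shift k b) (shift k s) := Agree.shift (hsb'.mono (by omega)).symm
    constructor
    · rintro ⟨i, hi, hbi⟩ hlt
      rw [hsb i (by omega)] at hbi
      have hbA := lex_shift_lt_of_exists_digit_lt hbm ha.le (fun i hi => (hmin i (by omega)).1)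
        ⟨i, hi, hbi⟩
      exact not_ltUpTo_of_lex_le hbA.le (hlt.congr (fun _ _ => rfl) hagree.symm)
    · rintro ⟨i, hi, hbi⟩ hlt
      rw [hsb i (by omega)] at hbi
      have hbA := reflectSeq_lex_shift_lt_of_exists_digit_pos hbm ha.le
        (fun i hi => (hmin i (by omega)).2) ⟨i, hi, hbi⟩
      exact not_ltUpTo_of_lex_le hbA.le (hlt.congr (fun _ _ => rfl) hagree.symm.reflectSeq)
  · obtain ⟨e, rfl⟩ := Nat.exists_eq_add_of_le (Nat.succ_le_of_lt hkp)
    rw [← shift_shift, hsA]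
    exact ⟨fun _ => not_ltUpTo_of_lex_le (ha.lex_shift_le e),
      fun _ => not_ltUpTo_of_lex_le (ha.reflectSeq_lex_shift_le e)⟩

theorem exists_agree_mul_and_ltUpTo {n : ℕ} (hn : 0 < n) (hA : shift n A = A)
    (h : toLex A < toLex t) : ∃ J, Agree (J * n) t A ∧ LtUpTo n A (shift (J * n) t) := by
  obtain ⟨d, hag, hlt⟩ := h
  have hd : d / n * n ≤ d := Nat.div_mul_le_self d n
  have hag' : Agree (d / n * n) A t := fun i hi => hag i (hi.trans_le hd)
  have hmod : d < d / n * n + n := by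
    conv_lhs => rw [← Nat.div_add_mod' d n]
    exact Nat.add_lt_add_left (Nat.mod_lt d hn) _
  have hlt' : LtUpTo (d / n * n + n) A t := ⟨d, hmod, hag, hlt⟩
  rw [hag'.ltUpTo_add_iff, shift_mul_eq hA] at hlt'
  exact ⟨d / n, hag'.symm, hlt'⟩

theorem LexBounded.lex_shift_lt (hb : LexBounded m g b) (hg : ∀ i, g i ≤ m) {k : ℕ}
    (hk : ∃ i < k, b i < m) : toLex (shift k b) < toLex g :=
  lex_shift_lt_of_exists_digit_lt hb.1 hg (fun i _ => (hb.2 i).1) hk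

theorem LexBounded.reflectSeq_lex_shift_lt (hb : LexBounded m g b) (hg : ∀ i, g i ≤ m) {k : ℕ}
    (hk : ∃ i < k, 0 < b i) : toLex (UniqueExpansion.reflectSeq m (shift k b)) < toLex g :=
  reflectSeq_lex_shift_lt_of_exists_digit_pos hb.1 hg (fun i _ => (hb.2 i).2) hk

theorem LexBounded.tailsLt_shift {n : ℕ} {C : ℕ → ℕ} (hT : IsTower m n C)
    (hb : LexBounded m g b) (hgm : ∀ i, g i ≤ m) (hg : Agree n g C) (hp : b p < m)
    (hC : Agree n (shift (p + 1) b) C) : TailsLt m g (shift (p + 1) b) := by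
  intro K
  rw [shift_shift]
  refine ⟨hb.lex_shift_lt hgm ⟨p, by omega, hp⟩, ?_⟩
  rcases lt_or_ge K n with hK | hK
  · rw [← shift_shift]
    have := hT.reflectSeq_shift_ltUpTo (k := 0) (by simpa using hC) (by simpa using hK)
    rw [pow_zero, mul_one] at this
    exact (this.congr (fun _ _ => rfl) hg.symm).lex_lt
  · obtain ⟨i, rfl⟩ := Nat.exists_eq_add_one_of_ne_zero hT.pos.ne'
    refine hb.reflectSeq_lex_shift_lt hgm ⟨p + 1 + i, by omega, ?_⟩
    rw [show b (p + 1 + i) = C i from hC i i.lt_succ_self]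
    exact hT.last_pos 0 i (by simp)

theorem digit_add_mul_lt (ha : IsAdmissibleBlock m a) (hp : b p < m) {J : ℕ}
    (hJ : Agree (J * a.length) (shift (p + 1) b) (periodicSeq a)) : b (p + J * a.length) < m := by
  have hn := ha.length_pos
  cases J with
  | zero => simpa using hp
  | succ J =>
    have hi : J * a.length + (a.length - 1) < (J + 1) * a.length := by
      rw [Nat.succ_mul]
      omega
    have hA : periodicSeq a (J * a.length + (a.length - 1)) = periodicSeq a (a.length - 1) :=
      congrFun (shift_mul_eq (shift_periodicSeq a) J) (a.length - 1)
    have hlast := (hJ _ hi).trans hA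
    rw [shift, show p + 1 + (J * a.length + (a.length - 1)) = p + (J + 1) * a.length by
      rw [Nat.succ_mul]; omega] at hlast
    exact hlast ▸ ha.last_lt

theorem HasBlockForm.of_isMatched_of_blockTail (hω : IsMatched m a (prefixWord P b))
    (h : BlockTail m a ℓ 0 (shift P b)) : HasBlockForm m a ℓ b := by
  obtain ⟨r, i, j, l, -, hi, hir, hl, hprod⟩ := h.isBlockProduct
  refine ⟨_, 0, r, i, j, l, hω, .inl rfl, hi, hir, hl, ?_⟩
  rw [wordPow_zero, ExtWord.append_nil, hprod, ExtWord.append, prependWord_prefixWord]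

theorem HasBlockForm.of_isMatched_of_periodic (hℓ : 0 < ℓ) (hω : IsMatched m a (prefixWord P b))
    (h : shift P b = periodicSeq a) : HasBlockForm m a ℓ b := by
  refine ⟨_, ⊤, 0, fun _ => 0, fun _ => 0, fun _ => 0, hω, .inr rfl, by simp, hℓ, by simp, ?_⟩
  rw [wordPow_top, ExtWord.append, ExtWord.append, ← h, prependWord_prefixWord]

theorem LexBounded.hasBlockForm (ha : IsAdmissibleBlock m a) (hℓ : 0 < ℓ)
    (hg : Agree (a.length * 2 ^ ℓ) g (towerSeq m a))
    (hg' : UniqueExpansion.reflectSeq m (shift (a.length * 2 ^ ℓ) g) = g)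
    (hb : LexBounded m g b) (hp : b p < m)
    (hpA : toLex (periodicSeq a) ≤ toLex (shift (p + 1) b))
    (hmin : ∀ i < p, (b i < m → toLex (shift (i + 1) b) < toLex (periodicSeq a)) ∧
      (0 < b i → toLex (UniqueExpansion.reflectSeq m (shift (i + 1) b)) < toLex (periodicSeq a))) :
    HasBlockForm m a ℓ b := by
  have hplus := isPlus_towerSeq m ha.ne_nil
  have hg₀ : Agree a.length g (towerSeq m a) :=
    hg.mono (Nat.le_mul_of_pos_right _ (Nat.two_pow_pos ℓ))
  have hlt : ∀ {i}, b i < m → ¬ LtUpTo a.length (towerSeq m a) (shift (i + 1) b) := fun hi h =>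
    not_ltUpTo_of_lex_le ((hb.2 _).1 hi).le (h.congr hg₀.symm fun _ _ => rfl)
  have hag : Agree (a.length - 1) (shift (p + 1) b) (periodicSeq a) := by
    rcases hplus.agree_or_agree (not_ltUpTo_of_lex_le hpA) (hlt hp) with h | h
    · exact h.mono (Nat.sub_le _ _)
    · exact (h.mono (Nat.sub_le _ _)).trans hplus.agree.symm
  rcases hpA.eq_or_lt with heq | hAlt
  · have hω := isMatched_prefixWord ha hb.1 hmin hag (J := 0) (by simp [Agree]) (by simpa using hp)
    rw [zero_mul, add_zero] at hω
    exact .of_isMatched_of_periodic hℓ hω (toLex.injective heq).symm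
  · obtain ⟨J, hJ, hJlt⟩ :=
      exists_agree_mul_and_ltUpTo ha.length_pos (shift_periodicSeq a) hAlt
    have hlast := digit_add_mul_lt ha hp hJ
    rw [shift_shift, add_right_comm] at hJlt
    have hC : Agree a.length (shift (p + J * a.length + 1) b) (towerSeq m a) := by
      refine (hplus.agree_or_agree hJlt.asymm (hlt hlast)).resolve_left fun h => ?_
      exact (hJlt.congr (fun _ _ => rfl) h).asymm (hJlt.congr (fun _ _ => rfl) h)
    refine .of_isMatched_of_blockTail (isMatched_prefixWord ha hb.1 hmin hag hJ hlast) ?_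
    exact blockTail_of_tailsLt ha.isTower hℓ hg hg' (fun _ => hb.1 _)
      (hb.tailsLt_shift ha.isTower (le_of_reflectSeq_eq hg') hg₀ hlast hC)
      (by simpa using hC)

end

/-! ### The bases `q_ℓ` -/

section

variable {m ℓ k : ℕ} {q p q₀ q₀' : ℝ} {a : List ℕ} {b g : ℕ → ℕ}

theorem IsSmallestPeriodicBlock.isAdmissibleBlock (ha : IsSmallestPeriodicBlock m q₀ a)
    (hm : 1 ≤ m) (hcomp : IsComponent m q₀ q₀') (hq₀ : ((m / 2 + 1 : ℕ) : ℝ) < q₀) :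
    IsAdmissibleBlock m a := by
  obtain ⟨hne, hA, hmin⟩ := ha
  have hq : 1 < q₀ := lt_of_le_of_lt (by exact_mod_cast Nat.le_add_left 1 _) hq₀
  obtain ⟨hAm, hv⟩ := (isExpansion_iff hq).mp hA.1
  have hsh := hA.lex_shift_le hq hcomp.lt.le
  refine ⟨hne, hmin, hAm, lt_of_periodic_of_base_lt hq hcomp.lt hAm hv hsh ?_, hsh,
    hA.reflectSeq_lex_shift_le hq hcomp.lt.le (hA.lt_head hm hcomp.lt.le hq₀)
      (hcomp.frequently_mem hq₀)⟩
  rw [Nat.sub_add_cancel (List.length_pos_iff.mpr hne), shift_periodicSeq]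

theorem agree_prependWord_cWord (ha : a ≠ []) (k : ℕ) (s : ℕ → ℕ) :
    Agree (a.length * 2 ^ k) (prependWord (cWord m a k) s) (towerSeq m a) := by
  rw [cWord_eq_prefixWord m ha]
  exact agree_prependWord_prefixWord _ _ _

theorem shift_periodicSeq_pairWord (hT : IsTower m a.length (towerSeq m a)) (k : ℕ) :
    shift (a.length * 2 ^ k) (periodicSeq (pairWord m a k k)) =
      reflectSeq m (periodicSeq (pairWord m a k k)) := by
  have hrefl := reflectSeq_shift_periodicSeq_pairWord hT k
  conv_rhs => rw [← hrefl]
  exact (reflectSeq_reflectSeq fun _ => le_of_reflectSeq_eq hrefl _).symm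

theorem isPlus_periodicSeq_pairWord (hT : IsTower m a.length (towerSeq m a)) (k : ℕ) :
    IsPlus (a.length * 2 ^ (k + 1)) (periodicSeq (pairWord m a k k)) (towerSeq m a) := by
  have hag := agree_periodicSeq_pairWord m hT.ne_nil k k
  rw [pow_succ, ← mul_assoc, mul_two]
  refine .of_shift hag ((hT.isPlus k).congr ?_ fun _ _ => rfl)
  rw [shift_periodicSeq_pairWord hT]
  exact hag.symm.reflectSeq

theorem val_periodicSeq_pairWord (hT : IsTower m a.length (towerSeq m a)) (hq : 1 < q)
    (hc : IsExpansion m q 1 (prependWord (cWord m a (k + 1)) fun _ => 0)) :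
    val q (periodicSeq (pairWord m a k k)) = 1 := by
  obtain ⟨hcm, hv⟩ := (isExpansion_iff hq).mp hc
  have hper : shift (a.length * 2 ^ (k + 1)) (periodicSeq (pairWord m a k k)) =
      periodicSeq (pairWord m a k k) := by
    rw [pow_succ, ← mul_assoc, mul_two, ← shift_shift, shift_periodicSeq_pairWord hT,
      shift_reflectSeq, reflectSeq_shift_periodicSeq_pairWord hT]
  refine val_eq_one_of_isPlus hq hcm
    (le_of_reflectSeq_eq (reflectSeq_shift_periodicSeq_pairWord hT k)) hv ?_ hper
    ((isPlus_periodicSeq_pairWord hT k).congr (fun _ _ => rfl)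
      (agree_prependWord_cWord hT.ne_nil (k + 1) _).symm)
  rw [← length_cWord m hT.ne_nil, shift_prependWord]

theorem HasBlockForm.isUnivoque (hb : HasBlockForm m a ℓ b) (ha : IsAdmissibleBlock m a)
    (hp : 1 < p) (hc : IsExpansion m p 1 (prependWord (cWord m a ℓ) fun _ => 0)) (hpq : p < q) :
    IsUnivoque m q b := by
  obtain ⟨hcm, hv⟩ := (isExpansion_iff hp).mp hc
  have hag := agree_prependWord_cWord (m := m) ha.ne_nil ℓ fun _ => 0
  have hlen := Nat.sub_add_cancel (ha.isTower.length_pos ℓ)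
  have hlast := ha.isTower.last_pos ℓ _ hlen
  rw [← hag _ (by omega)] at hlast
  have hlt := val_lt_of_base_lt hp hpq hcm hlast
  rw [hv] at hlt
  exact (hb.lexBounded ha hag).isUnivoque (hp.trans hpq) hcm hlt.le (.inl hlt)

theorem HasBlockForm.not_isUnivoque (hb : HasBlockForm m a ℓ b) (ha : IsAdmissibleBlock m a)
    (hq : 1 < q) (hv : val q (periodicSeq a) = 1) : ¬ IsUnivoque m q b := fun h =>
  hb.not_lexBounded_periodicSeq ha (h.lexBounded hq ha.le hv ha.lex_shift_le)

theorem LexBounded.hasBlockForm_or_reflectSeq (ha : IsAdmissibleBlock m a) (hℓ : 0 < ℓ)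
    (hg : Agree (a.length * 2 ^ ℓ) g (towerSeq m a))
    (hg' : UniqueExpansion.reflectSeq m (shift (a.length * 2 ^ ℓ) g) = g)
    (hb : LexBounded m g b) (hbA : ¬ LexBounded m (periodicSeq a) b) :
    HasBlockForm m a ℓ b ∨ HasBlockForm m a ℓ (UniqueExpansion.reflectSeq m b) := by
  classical
  have hex := not_forall.mp fun h => hbA ⟨hb.1, h⟩
  have hmin : ∀ i < Nat.find hex, _ := fun i hi => not_not.mp (Nat.find_min hex hi)
  rcases not_and_or.mp (Nat.find_spec hex) with h | h
  · obtain ⟨hp, hpA⟩ := Classical.not_imp.mp h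
    exact .inl (hb.hasBlockForm ha hℓ hg hg' hp (not_lt.mp hpA) hmin)
  · obtain ⟨hp, hpA⟩ := Classical.not_imp.mp h
    refine .inr (hb.reflectSeq.hasBlockForm ha hℓ hg hg' (p := Nat.find hex) ?_ (not_lt.mp hpA)
      fun i hi => ⟨fun h' => (hmin i hi).2 ?_, fun h' => ?_⟩)
    · exact Nat.sub_lt (hp.trans_le (hb.1 _)) hp
    · simp only [UniqueExpansion.reflectSeq] at h'
      omega
    · rw [shift_reflectSeq, reflectSeq_reflectSeq_shift hb.1]
      refine (hmin i hi).1 ?_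
      simp only [UniqueExpansion.reflectSeq] at h'
      omega

theorem IsUnivoque.hasBlockForm_or_reflectSeq (hb : IsUnivoque m p b)
    (ha : IsAdmissibleBlock m a) (hℓ : 0 < ℓ) (hp : 1 < p)
    (hc : IsExpansion m p 1 (prependWord (cWord m a (ℓ + 1)) fun _ => 0)) (hq₀ : 1 < q₀)
    (hA : IsQuasiGreedy m q₀ 1 (periodicSeq a)) (hb₀ : ¬ IsUnivoque m q₀ b) :
    HasBlockForm m a ℓ b ∨ HasBlockForm m a ℓ (UniqueExpansion.reflectSeq m b) := by
  have hag := agree_periodicSeq_pairWord m ha.ne_nil ℓ ℓ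
  have hrefl := reflectSeq_shift_periodicSeq_pairWord ha.isTower ℓ
  have hlex := hb.lexBounded hp (le_of_reflectSeq_eq hrefl)
    (val_periodicSeq_pairWord ha.isTower hp hc) fun k =>
      (ha.isTower.lex_shift_le_of_reflectSeq_shift_eq hag hrefl k).1
  have hv := ((isExpansion_iff hq₀).mp hA.1).2
  exact hlex.hasBlockForm_or_reflectSeq ha hℓ hag hrefl fun h =>
    hb₀ (h.isUnivoque hq₀ ha.le hv.le (.inr (hA.val_shift_pos hq₀)))

end

end UniqueExpansion

theorem corollary5p6 (m : ℕ) (hm : 1 ≤ m) (q₀ q₀' : ℝ)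
    (hcomp : UniqueExpansion.IsComponent m q₀ q₀')
    (hq₀ : ((m / 2 + 1 : ℕ) : ℝ) < q₀)
    (a : List ℕ) (ha : UniqueExpansion.IsSmallestPeriodicBlock m q₀ a)
    (ℓ : ℕ) (hℓ : 1 ≤ ℓ) (p p' : ℝ)
    -- `p = q_ℓ` and `p' = q_{ℓ+1}`: the greedy expansions of `1` are `c_ℓ 0^∞`, `c_{ℓ+1} 0^∞`
    (hp1 : 1 < p)
    (hp : UniqueExpansion.IsGreedy m p 1
      (UniqueExpansion.prependWord (UniqueExpansion.cWord m a ℓ) (fun _ => 0)))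
    (hp1' : 1 < p')
    (hp' : UniqueExpansion.IsGreedy m p' 1
      (UniqueExpansion.prependWord (UniqueExpansion.cWord m a (ℓ + 1)) (fun _ => 0)))
    (q : ℝ) (hq : q ∈ Set.Ioc p p') (b : ℕ → ℕ) :
    b ∈ UniqueExpansion.univoqueSeqs m q \ UniqueExpansion.univoqueSeqs m q₀ ↔
      UniqueExpansion.HasBlockForm m a ℓ b ∨
      ∃ b', UniqueExpansion.HasBlockForm m a ℓ b' ∧ b = UniqueExpansion.reflectSeq m b' := by
  have hq₀1 : 1 < q₀ := lt_of_le_of_lt (by exact_mod_cast Nat.le_add_left 1 _) hq₀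
  have hq1 : 1 < q := hp1.trans hq.1
  have hA := ha.2.1
  have hv := ((UniqueExpansion.isExpansion_iff hq₀1).mp hA.1).2
  have hblock := ha.isAdmissibleBlock hm hcomp hq₀
  rw [Set.mem_sdiff, UniqueExpansion.mem_univoqueSeqs_iff hq1 (hq.2.trans (hp'.1.base_le hp1')),
    UniqueExpansion.mem_univoqueSeqs_iff hq₀1 hcomp.lt.le]
  constructor
  · rintro ⟨hb, hb₀⟩
    exact ((hb.mono_base hq1 hq.2).hasBlockForm_or_reflectSeq hblock hℓ hp1' hp'.1 hq₀1 hA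
      hb₀).imp_right fun h => ⟨_, h, (UniqueExpansion.reflectSeq_reflectSeq hb.1).symm⟩
  · rintro (h | ⟨b', h, rfl⟩)
    · exact ⟨h.isUnivoque hblock hp1 hp.1 hq.1, h.not_isUnivoque hblock hq₀1 hv⟩
    · have hb' := h.isUnivoque hblock hp1 hp.1 hq.1
      refine ⟨hb'.reflectSeq, fun hb₀ => h.not_isUnivoque hblock hq₀1 hv ?_⟩
      exact UniqueExpansion.reflectSeq_reflectSeq hb'.1 ▸ hb₀.reflectSeq
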